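/- Let $\lambda$ be a partition of an integer $n \ge 1$ that is symmetric (i.e. equal to its transpose $\lambda'$) and different from $(1)$. Let $M^\lambda$ be the free $\mathbb{Z}$-module on the set of $\lambda$-tabloids $\{a\}$ (i.e. $\lambda$-tableaux $a$, bijectively filled with $n$ entries, with unordered rows), equipped with the bilinear form for which the tabloids are orthonormal. The Specht module $S^\lambda \subseteq M^\lambda$ is the $\mathbb{Z}$-span of the polytabloids $\sum_{\sigma \in C_a} \varepsilon_\sigma \{a\}\sigma$, where $a$ runs over the $\lambda$-tableaux, $C_a$ is the column stabilizer of $a$ in the symmetric group $\mathcal{S}_n$, and $\varepsilon_\sigma$ is the sign of $\sigma$. Let $n_\lambda$ be the rank of $S^\lambda$ over $\mathbb{Z}$, and let $d_1 \mid d_2 \mid \dots \mid d_{n_\lambda}$ be the (nonnegative) elementary divisors of the Gram matrix, with respect to any $\mathbb{Z}$-basis of $S^\lambda$, of the form restricted to $S^\lambda$. Then $n_\lambda$ is even and positive, all $d_k$ are positive, and the following holds. Let $$m := \frac{d_{n_\lambda/2+1}}{d_{n_\lambda/2}}$$ be the middle jump factor, and let $H$ be the product of the hook lengths of the cells of $\lambda$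 on the main diagonal. Then $H/m$ is a square in $\mathbb{Q}$. -/

import Mathlib

/-! ### Elementary divisors of a square integral matrix -/

namespace ElementaryDivisors

/-- `d 0 ∣ d 1 ∣ d 2 ∣ …` are nonnegative integers such that `A` is equivalent over `ℤ` to the
diagonal matrix with diagonal `d`. (The tuple `d` is uniquely determined by `A`.) -/
def IsSmithForm {n : ℕ} (A : Matrix (Fin n) (Fin n) ℤ) (d : Fin n → ℕ) : Prop :=
  (∀ i j, i ≤ j → d i ∣ d j) ∧
    ∃ U V : Matrix (Fin n) (Fin n) ℤ, IsUnit U.det ∧ IsUnit V.det ∧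
      U * A * V = Matrix.diagonal fun i => (d i : ℤ)

/-- Equivalence of integral matrices. -/
def Equivalent {ι : Type} [Fintype ι] [DecidableEq ι] (A B : Matrix ι ι ℤ) : Prop :=
  ∃ U V : Matrix ι ι ℤ, IsUnit U.det ∧ IsUnit V.det ∧ U * A * V = B

section
variable {ι : Type} [Fintype ι] [DecidableEq ι]

theorem Equivalent.refl (A : Matrix ι ι ℤ) : Equivalent A A :=
  ⟨1, 1, by simp, by simp, by simp⟩

theorem Equivalent.trans {A B C : Matrix ι ι ℤ} (h : Equivalent A B) (h' : Equivalent B C) :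
    Equivalent A C := by
  obtain ⟨U, V, hU, hV, rfl⟩ := h
  obtain ⟨U', V', hU', hV', rfl⟩ := h'
  refine ⟨U' * U, V * V', ?_, ?_, ?_⟩
  · rw [Matrix.det_mul]; exact hU'.mul hU
  · rw [Matrix.det_mul]; exact hV.mul hV'
  · simp only [Matrix.mul_assoc]

theorem Equivalent.left (A U : Matrix ι ι ℤ) (hU : IsUnit U.det) : Equivalent A (U * A) :=
  ⟨U, 1, hU, by simp, by simp⟩

theorem Equivalent.right (A V : Matrix ι ι ℤ) (hV : IsUnit V.det) : Equivalent A (A * V) :=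
  ⟨1, V, by simp, hV, by simp⟩

theorem Equivalent.permute (A : Matrix ι ι ℤ) (σ τ : Equiv.Perm ι) :
    Equivalent A (A.submatrix σ τ) := by
  refine ⟨(1 : Matrix ι ι ℤ).submatrix σ id, (1 : Matrix ι ι ℤ).submatrix id τ, ?_, ?_, ?_⟩
  · rw [Matrix.det_permute]; simp
  · rw [Matrix.det_permute']; simp
  · ext i j
    simp [Matrix.mul_apply, Matrix.one_apply]

theorem Equivalent.reindex {κ : Type} [Fintype κ] [DecidableEq κ] (e : κ ≃ ι)
    {A B : Matrix ι ι ℤ} (h : Equivalent A B) :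
    Equivalent (A.submatrix e e) (B.submatrix e e) := by
  obtain ⟨U, V, hU, hV, rfl⟩ := h
  refine ⟨U.submatrix e e, V.submatrix e e, ?_, ?_, ?_⟩
  · rwa [Matrix.det_submatrix_equiv_self]
  · rwa [Matrix.det_submatrix_equiv_self]
  · simp [Matrix.submatrix_mul_equiv]

/-- A matrix equivalent to `A ≠ 0` whose `(o, o)` entry divides every entry of it. -/
theorem exists_pivot (A : Matrix ι ι ℤ) (hA : A ≠ 0) (o : ι) :
    ∃ B, Equivalent A B ∧ B o o ≠ 0 ∧ ∀ C, Equivalent B C → C o o = B o o →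
      (∀ j, B o o ∣ C o j) ∧ (∀ i, B o o ∣ C i o) := by
  classical
  have hex : ∃ k : ℕ, ∃ B, Equivalent A B ∧ B o o ≠ 0 ∧ (B o o).natAbs = k := by
    obtain ⟨i, j, hij⟩ : ∃ i j, A i j ≠ 0 := by
      by_contra! h
      exact hA (by ext i j; simpa using h i j)
    exact ⟨_, _, Equivalent.permute A (Equiv.swap o i) (Equiv.swap o j), by simpa using hij, rfl⟩
  obtain ⟨B, hAB, hB0, hBk⟩ := Nat.find_spec hex
  have hmin : ∀ C, Equivalent A C → ∀ i j, C i j ≠ 0 → (B o o).natAbs ≤ (C i j).natAbs := by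
    intro C hC i j hij
    rw [hBk]
    exact Nat.find_min' hex ⟨_, hC.trans (Equivalent.permute C (Equiv.swap o i) (Equiv.swap o j)),
      by simpa using hij, by simp⟩
  have key : ∀ b : ℤ, (b % B o o ≠ 0 → (B o o).natAbs ≤ (b % B o o).natAbs) → B o o ∣ b := by
    intro b hb
    by_contra hnd
    have h1 := hb (fun h => hnd (Int.dvd_of_emod_eq_zero h))
    have h2 := Int.emod_lt_abs b hB0
    have h3 := Int.emod_nonneg b hB0
    rw [Int.abs_eq_natAbs] at h2
    omega
  refine ⟨B, hAB, hB0, fun C hBC hC => ⟨fun j => ?_, fun i => ?_⟩⟩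
  · by_cases hj : j = o
    · subst hj; rw [hC]
    · apply key
      have := hmin _ ((hAB.trans hBC).trans (Equivalent.right C
        (Matrix.transvection o j (-(C o j / B o o)))
        (by rw [Matrix.det_transvection_of_ne _ _ (Ne.symm hj)]; simp))) o j
      rw [Matrix.mul_transvection_apply_same, hC] at this
      have e : C o j + -(C o j / B o o) * B o o = C o j % B o o := by
        rw [Int.emod_def]; ring
      rwa [e] at this
  · by_cases hi : i = o
    · subst hi; rw [hC]
    · apply key
      have := hmin _ ((hAB.trans hBC).trans (Equivalent.left C
        (Matrix.transvection i o (-(C i o / B o o)))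
        (by rw [Matrix.det_transvection_of_ne _ _ hi]; simp))) i o
      rw [Matrix.transvection_mul_apply_same, hC] at this
      have e : C i o + -(C i o / B o o) * B o o = C i o % B o o := by
        rw [Int.emod_def]; ring
      rwa [e] at this

end

theorem exists_blocks {n : ℕ} (A : Matrix (Unit ⊕ Fin n) (Unit ⊕ Fin n) ℤ) (hA : A ≠ 0) :
    ∃ (g : ℕ) (D : Matrix (Fin n) (Fin n) ℤ), (∀ i j, (g : ℤ) ∣ D i j) ∧
      Equivalent A (Matrix.fromBlocks (Matrix.of fun _ _ => (g : ℤ)) 0 0 D) := by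
  obtain ⟨B, hAB, hB0, hB⟩ := exists_pivot A hA (Sum.inl ())
  set p := B (Sum.inl ()) (Sum.inl ()) with hp
  obtain ⟨hr, hc⟩ := hB B (Equivalent.refl B) rfl
  choose r hr using hr
  choose c hc using hc
  let R : Matrix Unit (Fin n) ℤ := Matrix.of fun _ j => r (Sum.inr j)
  let K : Matrix (Fin n) Unit ℤ := Matrix.of fun i _ => c (Sum.inr i)
  let P : Matrix Unit Unit ℤ := Matrix.of fun _ _ => p
  have hBb : B = Matrix.fromBlocks P (P * R) (K * P) B.toBlocks₂₂ := by
    ext (i | i) (j | j)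
    · rfl
    · simp [P, R, Matrix.mul_apply, hr]
    · simp [P, K, Matrix.mul_apply, hc, mul_comm]
    · rfl
  let D : Matrix (Fin n) (Fin n) ℤ := B.toBlocks₂₂ - K * P * R
  have hBD : Equivalent B (Matrix.fromBlocks P 0 0 D) := by
    refine ⟨Matrix.fromBlocks 1 0 (-K) 1, Matrix.fromBlocks 1 (-R) 0 1, ?_, ?_, ?_⟩
    · simp
    · simp
    · conv_lhs => rw [hBb]
      simp only [Matrix.fromBlocks_multiply, D]
      congr 1 <;> simp [Matrix.mul_assoc, sub_eq_add_neg, add_comm]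
  have hpD : ∀ i j, p ∣ D i j := by
    intro i j
    let E : Matrix Unit (Fin n) ℤ := Matrix.of fun _ k => if k = i then 1 else 0
    have h1 : Equivalent (Matrix.fromBlocks P 0 0 D) (Matrix.fromBlocks P (E * D) 0 D) := by
      refine ⟨Matrix.fromBlocks 1 E 0 1, 1, by simp, by simp, ?_⟩
      simp [Matrix.fromBlocks_multiply]
    have h2 := (hB _ (hBD.trans h1) rfl).1 (Sum.inr j)
    simpa [E, Matrix.mul_apply] using h2
  refine ⟨p.natAbs, D, fun i j => Int.natAbs_dvd.2 (hpD i j), (hAB.trans hBD).trans ?_⟩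
  refine ⟨Matrix.fromBlocks (Matrix.of fun _ _ => p.sign) 0 0 1, 1, ?_, by simp, ?_⟩
  · rw [Matrix.det_fromBlocks_zero₂₁]
    simpa [Int.isUnit_iff_natAbs_eq] using Int.natAbs_sign_of_ne_zero hB0
  · rw [Matrix.mul_one, Matrix.fromBlocks_multiply]
    congr 1
    · ext
      simp [P, Matrix.mul_apply]
    all_goals simp

theorem exists_isSmithForm {n : ℕ} (A : Matrix (Fin n) (Fin n) ℤ) : ∃ d, IsSmithForm A d := by
  induction n with
  | zero => exact ⟨fun _ => 0, fun i => i.elim0, 1, 1, by simp, by simp, by ext i; exact i.elim0⟩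
  | succ n ih =>
    by_cases hA : A = 0
    · exact ⟨fun _ => 0, fun _ _ _ => dvd_rfl, 1, 1, by simp, by simp, by simp [hA]⟩
    let e : Fin (n + 1) ≃ Unit ⊕ Fin n :=
      (finSuccEquiv n).trans ((Equiv.optionEquivSumPUnit _).trans (Equiv.sumComm _ _))
    have e0 : e 0 = Sum.inl () := by simp [e]
    have es : ∀ i : Fin n, e i.succ = Sum.inr i := fun i => by simp [e]
    have hA' : A.submatrix e.symm e.symm ≠ 0 := by
      intro h
      apply hA
      ext i j
      simpa using congrFun (congrFun h (e i)) (e j)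
    obtain ⟨g, D, hg, hAD⟩ := exists_blocks _ hA'
    obtain ⟨d, hd, U, V, hU, hV, hUV⟩ := ih D
    have hgd : ∀ i, g ∣ d i := by
      intro i
      have h := congrFun (congrFun hUV i) i
      rw [Matrix.diagonal_apply_eq] at h
      rw [← Int.natCast_dvd_natCast, ← h]
      simp only [Matrix.mul_apply]
      exact Finset.dvd_sum fun k _ => Dvd.dvd.mul_right
        (Finset.dvd_sum fun l _ => Dvd.dvd.mul_left (hg l k) _) _
    have h2 : Equivalent (Matrix.fromBlocks (Matrix.of fun (_ _ : Unit) => (g : ℤ)) 0 0 D)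
        (Matrix.fromBlocks (Matrix.of fun (_ _ : Unit) => (g : ℤ)) 0 0
          (Matrix.diagonal fun i => (d i : ℤ))) := by
      refine ⟨Matrix.fromBlocks 1 0 0 U, Matrix.fromBlocks 1 0 0 V, ?_, ?_, ?_⟩
      · simpa using hU
      · simpa using hV
      · simp [Matrix.fromBlocks_multiply, hUV]
    obtain ⟨U', V', hU', hV', h'⟩ := (hAD.trans h2).reindex e
    refine ⟨Fin.cons g d, ?_, U', V', hU', hV', ?_⟩
    · intro i j
      refine Fin.cases ?_ (fun i => ?_) i <;> refine Fin.cases ?_ (fun j => ?_) j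
      · simp
      · simp [hgd]
      · simp
      · simpa using hd i j
    · have : (A.submatrix e.symm e.symm).submatrix e e = A := by ext; simp
      rw [this] at h'
      rw [h']
      ext i j
      refine Fin.cases ?_ (fun i => ?_) i <;> refine Fin.cases ?_ (fun j => ?_) j <;>
        simp [e0, es, Matrix.diagonal_apply, (Fin.succ_ne_zero _).symm]

/-- The elementary divisors of `A`; the index `i : Fin n` stands for the `(i + 1)`st one. -/
noncomputable def elementaryDivisors {n : ℕ} (A : Matrix (Fin n) (Fin n) ℤ) : Fin n → ℕ :=
  (exists_isSmithForm A).choose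

end ElementaryDivisors

/-! ### Specht modules

A partition of `n` is a Young diagram `μ` with `n = μ.card`; cells `(i, j)` are numbered from `0`,
`i` being the row and `j` the column. -/

namespace Specht

/-- A `μ`-tableau: a bijective filling of the cells of `μ`. -/
abbrev Tableau (μ : YoungDiagram) : Type := μ.cells ≃ Fin μ.card

variable {μ : YoungDiagram}

/-- The row in which the entry `k` of `a` stands. -/
def Tableau.rowOf (a : Tableau μ) (k : Fin μ.card) : ℕ := (a.symm k).1.1

/-- The column in which the entry `k` of `a` stands. -/
def Tableau.colOf (a : Tableau μ) (k : Fin μ.card) : ℕ := (a.symm k).1.2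

/-- Two tableaux are row equivalent if their rows agree up to reordering. -/
def rowSetoid (μ : YoungDiagram) : Setoid (Tableau μ) :=
  Setoid.ker Tableau.rowOf

/-- A `μ`-tabloid: a `μ`-tableau with unordered rows. -/
def Tabloid (μ : YoungDiagram) : Type := Quotient (rowSetoid μ)

/-- The tabloid `{a}`. -/
def Tableau.tabloid (a : Tableau μ) : Tabloid μ := Quotient.mk (rowSetoid μ) a

/-- The permutation module `M^μ`, free over `ℤ` on the set of tabloids. -/
abbrev PermModule (μ : YoungDiagram) : Type := Tabloid μ →₀ ℤ

/-- The bilinear form on `M^μ` for which the tabloids are orthonormal. -/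
noncomputable def form (μ : YoungDiagram) : LinearMap.BilinForm ℤ (PermModule μ) :=
  Finsupp.linearCombination ℤ fun t => Finsupp.lapply t

open Classical in
theorem form_single (s t : Tabloid μ) :
    form μ (Finsupp.single s 1) (Finsupp.single t 1) = if s = t then 1 else 0 := by
  simp [form, Finsupp.single_apply, eq_comm]

/-- The symmetric group acts on tableaux entrywise. -/
def Tableau.act (a : Tableau μ) (σ : Equiv.Perm (Fin μ.card)) : Tableau μ := a.trans σ

/-- The column stabilizer `C_a` of `a`. -/
def columnStabilizer (a : Tableau μ) : Subgroup (Equiv.Perm (Fin μ.card)) where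
  carrier := {σ | ∀ k, a.colOf (σ k) = a.colOf k}
  one_mem' := fun _ => rfl
  mul_mem' := fun {σ τ} hσ hτ k => (hσ (τ k)).trans (hτ k)
  inv_mem' := fun {σ} hσ k => by simpa using (hσ (σ⁻¹ k)).symm

open Classical in
/-- The polytabloid `⟨a⟩`, the signed sum of the tabloids `{aσ}` with `σ ∈ C_a`. -/
noncomputable def polytabloid (a : Tableau μ) : PermModule μ :=
  ∑ σ : Equiv.Perm (Fin μ.card) with σ ∈ columnStabilizer a,
    Finsupp.single (a.act σ).tabloid ((Equiv.Perm.sign σ : ℤˣ) : ℤ)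

/-- The Specht module `S^μ`, the `ℤ`-linear span of the polytabloids. -/
noncomputable def spechtModule (μ : YoungDiagram) : Submodule ℤ (PermModule μ) :=
  Submodule.span ℤ (Set.range fun a : Tableau μ => polytabloid a)

/-- The rank `n_μ` of the Specht module. -/
noncomputable def spechtRank (μ : YoungDiagram) : ℕ := Module.finrank ℤ (spechtModule μ)

/-- The Gram matrix, with respect to a basis, of the form on `S^μ` restricted from `M^μ`. -/
noncomputable def gramMatrix {r : ℕ} (b : Module.Basis (Fin r) ℤ (spechtModule μ)) :
    Matrix (Fin r) (Fin r) ℤ :=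
  Matrix.of fun i j => form μ (b i) (b j)

/-- The hook length of a cell of `μ`: arm length plus leg length plus one. -/
def hookLength (μ : YoungDiagram) (c : ℕ × ℕ) : ℕ :=
  (μ.rowLen c.1 - (c.2 + 1)) + (μ.colLen c.2 - (c.1 + 1)) + 1

/-- The product of the hook lengths of the cells on the main diagonal. -/
def diagonalHookProduct (μ : YoungDiagram) : ℕ :=
  ∏ c ∈ μ.cells with c.1 = c.2, hookLength μ c

end Specht

/-! ### Symmetrizers of Young subgroups -/

namespace YoungSymm

open Equiv

section
variable {ι : Type*} [Fintype ι] [DecidableEq ι] {α β : Type*}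

/-! Let h be the product of all hook lengths of the symmetric diagram μ, and let a' be the transpose
of a tableau a. The map T : {a} ↦ sgn(a)⟨a'⟩ is well defined on tabloids, since a row permutation of
a is a column permutation of a' and the two signs cancel. It sends M^μ into S^μ, commutes with the
symmetric group up to the sign character, and is self-adjoint up to a global sign.

The core is T² = ±h on S^μ (`twist_twist`). Twisting by the sign exchanges row symmetrizers with
signed column symmetrizers, so T⟨a⟩ is ± the row symmetrization of ⟨a'⟩, and T²⟨a⟩ = ±CR⟨a⟩, where R
and C are the row symmetrizer and the signed column symmetrizer of a. By the sign lemma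
(`colSym_apply`), CR⟨a⟩ is ⟨a⟩ times the scalar (R⟨a⟩, ⟨a⟩). That scalar is h (`form_rowSym_poly`):
rows are peeled off from the top, and each row is symmetrized cell by cell from right to left. A
Garnir relation shows that the cell (i, j) contributes its hook length divided by the length of its
column from row i on; these denominators cancel against orders of column stabilizers.

The standard polytabloids form a ℤ-basis of S^μ, and their coefficients at the standard tabloids
form a unitriangular matrix. Since ⟨a⟩ = ±T{a'}, self-adjointness gives (⟨a⟩, v) = ±(Tv)({a'}).
Hence the Gram matrix is a unimodular matrix times the matrix of T (`exists_gramMatrix_eq`), and the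
two have the same elementary divisors. From T² = ±h these pair up as d_k d_{n+1-k} = h
(`mul_rev_of_sq_eq`); in particular they are positive. The rank n is even because T anticommutes
with a transposition and both have nonzero determinant.

In the middle, m = h / d_{n/2}². Reflection in the diagonal preserves hook lengths, so h is H times
a square, and H/m is a square. -/

open Classical in
/-- The Young subgroup of the permutations that preserve the fibres of `g`. -/
noncomputable def stab (g : ι → α) : Finset (Perm ι) := {σ | ∀ k, g (σ k) = g k}

theorem mem_stab {g : ι → α} {σ : Perm ι} : σ ∈ stab g ↔ ∀ k, g (σ k) = g k := by
  simp [stab]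

theorem one_mem_stab (g : ι → α) : (1 : Perm ι) ∈ stab g := by simp [mem_stab]

theorem mul_mem_stab {g : ι → α} {σ τ : Perm ι} (hσ : σ ∈ stab g) (hτ : τ ∈ stab g) :
    σ * τ ∈ stab g := by
  rw [mem_stab] at *
  intro k
  rw [Perm.mul_apply, hσ, hτ]

theorem inv_mem_stab {g : ι → α} {σ : Perm ι} (hσ : σ ∈ stab g) : σ⁻¹ ∈ stab g := by
  rw [mem_stab] at *
  intro k
  rw [← hσ, ← Perm.mul_apply, mul_inv_cancel, Perm.one_apply]

theorem swap_mem_stab {g : ι → α} {a b : ι} (h : g a = g b) : swap a b ∈ stab g := by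
  rw [mem_stab]
  intro k
  rw [swap_apply_def]
  split_ifs with h1 h2
  · rw [h1, h]
  · rw [h2, h]
  · rfl

theorem card_stab_pos (g : ι → α) : 0 < (stab g).card :=
  Finset.card_pos.2 ⟨1, one_mem_stab g⟩

/-- The fibres of `g`, with `a` split off. -/
def fixAt (g : ι → α) (a : ι) : ι → Option α := fun k => if k = a then none else some (g k)

theorem mem_stab_fixAt {g : ι → α} {a : ι} {σ : Perm ι} :
    σ ∈ stab (fixAt g a) ↔ σ ∈ stab g ∧ σ a = a := by
  simp only [mem_stab, fixAt]
  constructor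
  · intro h
    have ha : σ a = a := by
      by_contra hne
      simpa [hne] using h a
    refine ⟨fun k => ?_, ha⟩
    by_cases hk : k = a
    · rw [hk, ha]
    · have h1 : σ k ≠ a := fun h2 => hk (σ.injective (h2.trans ha.symm))
      simpa [hk, h1] using h k
  · rintro ⟨h, ha⟩ k
    by_cases hk : k = a
    · simp [hk, ha]
    · have h1 : σ k ≠ a := fun h2 => hk (σ.injective (h2.trans ha.symm))
      simp [hk, h1, h k]

/-- The fibres are the points outside `K` and the set `K`. -/
def onSet (K : Finset ι) : ι → Option ι := fun k => if k ∈ K then none else some k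

theorem mem_stab_onSet {K : Finset ι} {σ : Perm ι} :
    σ ∈ stab (onSet K) ↔ ∀ k, k ∉ K → σ k = k := by
  simp only [mem_stab, onSet]
  constructor
  · intro h k hk
    by_contra hne
    have := h k
    rw [if_neg hk] at this
    split_ifs at this
    exact hne (by simpa using this)
  · intro h k
    by_cases hk : k ∈ K
    · have : σ k ∈ K := by
        by_contra h1
        exact h1 (by rwa [σ.injective (h _ h1)])
      simp [hk, this]
    · rw [h k hk]

theorem apply_mem_of_mem_stab_onSet {K : Finset ι} {σ : Perm ι} (hσ : σ ∈ stab (onSet K)) {k : ι}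
    (hk : k ∈ K) : σ k ∈ K := by
  by_contra h1
  exact h1 (by rwa [σ.injective (mem_stab_onSet.1 hσ _ h1)])

theorem stab_fixAt_onSet {K : Finset ι} {a : ι} (ha : a ∉ K) :
    stab (fixAt (onSet (insert a K)) a) = stab (onSet K) := by
  ext σ
  rw [mem_stab_fixAt, mem_stab_onSet, mem_stab_onSet]
  constructor
  · rintro ⟨h, h1⟩ k hk
    by_cases hka : k = a
    · rw [hka, h1]
    · exact h k (by simp [hka, hk])
  · intro h
    exact ⟨fun k hk => h k fun h1 => hk (Finset.mem_insert_of_mem h1), h a ha⟩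

/-- Coset decomposition by the image y of `a`: every σ is uniquely a transposition `swap a y` times
an element fixing `a`. -/
theorem sum_stab_eq {V : Type*} [AddCommMonoid V] (g : ι → α) (a : ι) {Y : Finset ι}
    (hY : ∀ y, y ∈ Y ↔ g y = g a) (F : Perm ι → V) :
    ∑ σ ∈ stab g, F σ = ∑ y ∈ Y, ∑ τ ∈ stab (fixAt g a), F (swap a y * τ) := by
  rw [← Finset.sum_product']
  symm
  refine Finset.sum_bij' (fun p _ => swap a p.1 * p.2) (fun σ _ => (σ a, swap a (σ a) * σ))
    ?_ ?_ ?_ ?_ ?_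
  · rintro ⟨y, τ⟩ h
    simp only [Finset.mem_product, hY] at h
    exact mul_mem_stab (swap_mem_stab h.1.symm) (mem_stab_fixAt.1 h.2).1
  · intro σ hσ
    simp only [Finset.mem_product, hY]
    have h1 := mem_stab.1 hσ a
    exact ⟨h1, mem_stab_fixAt.2 ⟨mul_mem_stab (swap_mem_stab h1.symm) hσ, by simp⟩⟩
  · rintro ⟨y, τ⟩ h
    simp only [Finset.mem_product, hY] at h
    have h2 := (mem_stab_fixAt.1 h.2).2
    simp [h2, ← mul_assoc]
  · intro σ _
    simp [← mul_assoc]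
  · intro p _
    rfl

theorem card_stab_eq (g : ι → α) (a : ι) {Y : Finset ι} (hY : ∀ y, y ∈ Y ↔ g y = g a) :
    (stab g).card = Y.card * (stab (fixAt g a)).card := by
  rw [Finset.card_eq_sum_ones, sum_stab_eq g a hY]
  simp

omit [Fintype ι] in
theorem mem_iff_onSet_eq {K : Finset ι} {a : ι} (ha : a ∈ K) (y : ι) :
    y ∈ K ↔ onSet K y = onSet K a := by
  simp [onSet, ha]

/-! #### The operators -/

variable {V : Type*} [AddCommGroup V] (π : Perm ι →* Module.End ℤ V)

/-- The sum of the operators `χ σ • π σ` over the Young subgroup given by `g`. -/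
noncomputable def symm (χ : Perm ι →* ℤˣ) (g : ι → α) : Module.End ℤ V :=
  ∑ σ ∈ stab g, ((χ σ : ℤˣ) : ℤ) • π σ

variable {π} {χ : Perm ι →* ℤˣ} {g : ι → α}

theorem symm_apply (v : V) : symm π χ g v = ∑ σ ∈ stab g, ((χ σ : ℤˣ) : ℤ) • π σ v := by
  simp [symm]

theorem units_mul_self (u : ℤˣ) : (u : ℤ) * u = 1 := by
  rcases Int.units_eq_one_or u with rfl | rfl <;> simp

theorem units_inv (u : ℤˣ) : ((u⁻¹ : ℤˣ) : ℤ) = u := by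
  rcases Int.units_eq_one_or u with rfl | rfl <;> simp

theorem symm_mul_perm {τ : Perm ι} (hτ : τ ∈ stab g) :
    symm π χ g * π τ = ((χ τ : ℤˣ) : ℤ) • symm π χ g := by
  rw [symm, Finset.sum_mul, Finset.smul_sum]
  refine Finset.sum_bij' (fun σ _ => σ * τ) (fun σ _ => σ * τ⁻¹) ?_ ?_ ?_ ?_ ?_
  · exact fun σ hσ => mul_mem_stab hσ hτ
  · exact fun σ hσ => mul_mem_stab hσ (inv_mem_stab hτ)
  · simp
  · simp
  · intro σ _
    rw [map_mul, map_mul, smul_mul_assoc, smul_smul, Units.val_mul, mul_comm ((χ σ : ℤˣ) : ℤ),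
      ← mul_assoc, units_mul_self, one_mul]

theorem perm_mul_symm {τ : Perm ι} (hτ : τ ∈ stab g) :
    π τ * symm π χ g = ((χ τ : ℤˣ) : ℤ) • symm π χ g := by
  rw [symm, Finset.mul_sum, Finset.smul_sum]
  refine Finset.sum_bij' (fun σ _ => τ * σ) (fun σ _ => τ⁻¹ * σ) ?_ ?_ ?_ ?_ ?_
  · exact fun σ hσ => mul_mem_stab hτ hσ
  · exact fun σ hσ => mul_mem_stab (inv_mem_stab hτ) hσ
  · simp
  · simp
  · intro σ _
    rw [map_mul, map_mul, mul_smul_comm, smul_smul, Units.val_mul,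
      ← mul_assoc, units_mul_self, one_mul]

theorem symm_perm {τ : Perm ι} (hτ : τ ∈ stab g) (v : V) :
    symm π χ g (π τ v) = ((χ τ : ℤˣ) : ℤ) • symm π χ g v := by
  rw [← Module.End.mul_apply, symm_mul_perm hτ, LinearMap.smul_apply]

theorem perm_symm {τ : Perm ι} (hτ : τ ∈ stab g) (v : V) :
    π τ (symm π χ g v) = ((χ τ : ℤˣ) : ℤ) • symm π χ g v := by
  rw [← Module.End.mul_apply, perm_mul_symm hτ, LinearMap.smul_apply]

/-- Absorbing τ into the symmetrizer gives the same vector with the opposite sign, so twice it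
vanishes. -/
theorem symm_eq_zero [IsAddTorsionFree V] {τ : Perm ι} (hτ : τ ∈ stab g) {v : V}
    (h : π τ v = -((χ τ : ℤˣ) : ℤ) • v) : symm π χ g v = 0 := by
  have h1 := symm_perm (π := π) (χ := χ) hτ v
  rw [h, map_smul, neg_smul] at h1
  have h2 : (2 * ((χ τ : ℤˣ) : ℤ)) • symm π χ g v = 0 := by
    rw [mul_smul, two_smul]
    nth_rw 1 [← h1]
    simp
  rcases smul_eq_zero.1 h2 with h3 | h3
  · rcases Int.units_eq_one_or (χ τ) with h | h <;> simp [h] at h3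
  · exact h3

theorem symm_of_forall {v : V} (h : ∀ σ ∈ stab g, π σ v = ((χ σ : ℤˣ) : ℤ) • v) :
    symm π χ g v = (stab g).card • v := by
  rw [symm_apply, Finset.sum_congr rfl fun σ hσ => by
    rw [h σ hσ, smul_smul, units_mul_self, one_smul]]
  simp

theorem perm_mul_symm_conj (τ : Perm ι) :
    π τ * symm π χ g = symm π χ (fun k => g (τ⁻¹ k)) * π τ := by
  rw [symm, symm, Finset.mul_sum, Finset.sum_mul]
  refine Finset.sum_bij' (fun σ _ => τ * σ * τ⁻¹) (fun σ _ => τ⁻¹ * σ * τ) ?_ ?_ ?_ ?_ ?_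
  · intro σ hσ
    rw [mem_stab] at *
    intro k
    simp [hσ]
  · intro σ hσ
    rw [mem_stab] at *
    intro k
    have := hσ (τ k)
    simpa using this
  · intro σ _
    group
  · intro σ _
    group
  · intro σ _
    rw [map_mul, map_mul, map_mul, map_mul, mul_comm (χ τ), mul_assoc, ← map_mul χ τ, mul_inv_cancel,
      map_one, mul_one, mul_smul_comm, smul_mul_assoc, mul_assoc, ← map_mul π τ⁻¹, inv_mul_cancel,
      map_one, mul_one]

theorem perm_symm_conj (τ : Perm ι) (v : V) :
    π τ (symm π χ g v) = symm π χ (fun k => g (τ⁻¹ k)) (π τ v) := by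
  rw [← Module.End.mul_apply, perm_mul_symm_conj, Module.End.mul_apply]

theorem symm_congr {h : ι → β} (hgh : stab g = stab h) : symm π χ g = symm π χ h := by
  rw [symm, symm, hgh]

/-- A Jucys–Murphy factor. It serves both to enlarge a row symmetrizer by one cell and to extract
Garnir relations from the vanishing of a larger symmetrizer. -/
theorem symm_insert {K : Finset ι} {a : ι} (ha : a ∉ K) :
    symm π χ (onSet (insert a K)) =
      (1 + ∑ y ∈ K, ((χ (swap a y) : ℤˣ) : ℤ) • π (swap a y)) * symm π χ (onSet K) := by
  classical
  rw [symm, sum_stab_eq _ a (mem_iff_onSet_eq (Finset.mem_insert_self _ _)), stab_fixAt_onSet ha,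
    Finset.sum_insert ha, add_mul, one_mul, Finset.sum_mul]
  congr 1
  · rw [swap_self, ← Perm.one_def]
    simp only [one_mul]
    rfl
  · refine Finset.sum_congr rfl fun y _ => ?_
    rw [symm, Finset.mul_sum]
    refine Finset.sum_congr rfl fun τ _ => ?_
    rw [smul_mul_smul_comm, map_mul, map_mul, Units.val_mul]

theorem symm_commute {χ' : Perm ι →* ℤˣ} {h : ι → β}
    (hd : ∀ k, (∀ σ ∈ stab g, σ k = k) ∨ (∀ σ ∈ stab h, σ k = k)) :
    Commute (symm π χ g) (symm π χ' h) := by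
  refine Commute.sum_left _ _ _ fun σ hσ => Commute.sum_right _ _ _ fun τ hτ => ?_
  refine Commute.smul_left (Commute.smul_right (Commute.map ?_ π) _) _
  exact Perm.Disjoint.commute fun k => (hd k).imp (fun h => h σ hσ) (fun h => h τ hτ)

theorem symm_commute_perm {τ : Perm ι} (hd : ∀ k, (∀ σ ∈ stab g, σ k = k) ∨ τ k = k) :
    Commute (symm π χ g) (π τ) := by
  refine Commute.sum_left _ _ _ fun σ hσ => ?_
  refine Commute.smul_left (Commute.map ?_ π) _
  exact Perm.Disjoint.commute fun k => (hd k).imp (fun h => h σ hσ) id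

/-- The part of a Young subgroup that acts on a union `A` of fibres. -/
def inside (A : Finset ι) (g : ι → α) : ι → α ⊕ ι :=
  fun k => if k ∈ A then Sum.inl (g k) else Sum.inr k

theorem mem_stab_inside {A : Finset ι} {σ : Perm ι} :
    σ ∈ stab (inside A g) ↔ σ ∈ stab g ∧ ∀ k, k ∉ A → σ k = k := by
  simp only [mem_stab, inside]
  constructor
  · intro h
    have h1 : ∀ k, k ∉ A → σ k = k := by
      intro k hk
      have := h k
      rw [if_neg hk] at this
      split_ifs at this
      simpa using this
    refine ⟨fun k => ?_, h1⟩
    by_cases hk : k ∈ A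
    · have := h k
      rw [if_pos hk] at this
      split_ifs at this
      simpa using this
    · rw [h1 k hk]
  · rintro ⟨h, h1⟩ k
    by_cases hk : k ∈ A
    · have h2 : σ k ∈ A := by
        by_contra h2
        exact h2 (by rwa [σ.injective (h1 _ h2)])
      rw [if_pos hk, if_pos h2, h]
    · rw [h1 k hk]

theorem apply_mem_of_mem_stab_inside {A : Finset ι} {σ : Perm ι} (hσ : σ ∈ stab (inside A g))
    {k : ι} (hk : k ∈ A) : σ k ∈ A := by
  by_contra h1
  exact h1 (by rwa [σ.injective ((mem_stab_inside.1 hσ).2 _ h1)])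

/-- As `A` is a union of fibres, the Young subgroup preserves it, and the part acting on `A ∪ B` is
a direct product. -/
theorem symm_eq_mul (A B : Finset ι) (hAB : Disjoint A B)
    (hg : ∀ k ∈ A, ∀ l, g l = g k → l ∈ A) :
    symm π χ (inside (A ∪ B) g) = symm π χ (inside A g) * symm π χ (inside B g) := by
  classical
  rw [symm, symm, symm, Finset.sum_mul_sum, ← Finset.sum_product']
  symm
  have key : ∀ σ ∈ stab (inside A g), ∀ τ ∈ stab (inside B g), ∀ k ∈ A, (σ * τ) k = σ k := by
    intro σ _ τ hτ k hk
    rw [Perm.mul_apply, (mem_stab_inside.1 hτ).2 k (Finset.disjoint_left.1 hAB hk)]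
  refine Finset.sum_nbij (fun p => p.1 * p.2) ?_ ?_ ?_ ?_
  · rintro ⟨σ, τ⟩ h
    rw [Finset.mem_product, mem_stab_inside, mem_stab_inside] at h
    refine mem_stab_inside.2 ⟨mul_mem_stab h.1.1 h.2.1, fun k hk => ?_⟩
    rw [Finset.mem_union, not_or] at hk
    rw [Perm.mul_apply, h.2.2 k hk.2, h.1.2 k hk.1]
  · rintro ⟨σ, τ⟩ h ⟨σ', τ'⟩ h' he
    simp only [Finset.coe_product, Set.mem_prod, Finset.mem_coe] at h h' he
    have h1 : σ = σ' := by
      ext k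
      by_cases hk : k ∈ A
      · rw [← key σ h.1 τ h.2 k hk, he, key σ' h'.1 τ' h'.2 k hk]
      · rw [(mem_stab_inside.1 h.1).2 k hk, (mem_stab_inside.1 h'.1).2 k hk]
    subst h1
    rw [mul_left_cancel he]
  · intro σ hσ
    rw [Finset.mem_coe, mem_stab_inside] at hσ
    have hA : ∀ k, σ k ∈ A ↔ k ∈ A := fun k =>
      ⟨fun h => hg _ h _ (mem_stab.1 hσ.1 k).symm, fun h => hg _ h _ (mem_stab.1 hσ.1 k)⟩
    -- The first factor is σ restricted to `A` and extended by the identity.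
    set σ1 : Perm ι := (σ.subtypePerm (p := fun k => k ∈ A) hA).ofSubtype with hσ1
    have e1 : ∀ k ∈ A, σ1 k = σ k := fun k hk => Perm.ofSubtype_subtypePerm_of_mem hA hk
    have e2 : ∀ k, k ∉ A → σ1 k = k := fun k hk => Perm.ofSubtype_subtypePerm_of_not_mem hA hk
    have h1 : σ1 ∈ stab (inside A g) := by
      refine mem_stab_inside.2 ⟨mem_stab.2 fun k => ?_, e2⟩
      by_cases hk : k ∈ A
      · rw [e1 k hk, mem_stab.1 hσ.1]
      · rw [e2 k hk]
    refine ⟨(σ1, σ1⁻¹ * σ), ?_, by simp⟩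
    simp only [Finset.coe_product, Set.mem_prod, Finset.mem_coe]
    refine ⟨h1, mem_stab_inside.2
      ⟨mul_mem_stab (inv_mem_stab (mem_stab_inside.1 h1).1) hσ.1, fun k hk => ?_⟩⟩
    rw [Perm.mul_apply, Perm.inv_eq_iff_eq]
    by_cases hkA : k ∈ A
    · rw [e1 k hkA]
    · have h2 : k ∉ A ∪ B := by simp [hk, hkA]
      rw [hσ.2 k h2, e2 k hkA]
  · rintro ⟨σ, τ⟩ _
    simp only
    rw [smul_mul_smul_comm, map_mul, map_mul, Units.val_mul]

end

end YoungSymm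

/-! ### Tabloids, the action of the symmetric group, and the sign lemma -/

namespace Specht

open Equiv YoungSymm

variable {μ : YoungDiagram}

theorem Tableau.rowOf_act (a : Tableau μ) (σ : Perm (Fin μ.card)) (k : Fin μ.card) :
    Tableau.rowOf (a.act σ) k = a.rowOf (σ⁻¹ k) := rfl

theorem Tableau.colOf_act (a : Tableau μ) (σ : Perm (Fin μ.card)) (k : Fin μ.card) :
    Tableau.colOf (a.act σ) k = a.colOf (σ⁻¹ k) := rfl

theorem Tableau.mem (a : Tableau μ) (k : Fin μ.card) : (a.rowOf k, a.colOf k) ∈ μ :=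
  (YoungDiagram.mem_cells _).1 (a.symm k).2

theorem Tableau.colOf_lt (a : Tableau μ) (k : Fin μ.card) : a.colOf k < μ.rowLen (a.rowOf k) :=
  YoungDiagram.mem_iff_lt_rowLen.1 (a.mem k)

theorem Tableau.rowOf_lt (a : Tableau μ) (k : Fin μ.card) : a.rowOf k < μ.colLen (a.colOf k) :=
  YoungDiagram.mem_iff_lt_colLen.1 (a.mem k)

theorem Tableau.eq_of_cell_eq (a : Tableau μ) {k l : Fin μ.card} (hr : a.rowOf k = a.rowOf l)
    (hc : a.colOf k = a.colOf l) : k = l :=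
  a.symm.injective (Subtype.ext (Prod.ext hr hc))

theorem Tableau.exists_entry (a : Tableau μ) {r c : ℕ} (h : (r, c) ∈ μ) :
    ∃ k, a.rowOf k = r ∧ a.colOf k = c :=
  ⟨a ⟨(r, c), (YoungDiagram.mem_cells _).2 h⟩, by simp [Tableau.rowOf], by simp [Tableau.colOf]⟩

theorem Tableau.ext_cell {a b : Tableau μ} (hr : ∀ k, a.rowOf k = b.rowOf k)
    (hc : ∀ k, a.colOf k = b.colOf k) : a = b := by
  have : a.symm = b.symm := by
    ext k
    · exact hr k
    · exact hc k
  rw [← Equiv.symm_symm a, this, Equiv.symm_symm]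

/-- The row in which an entry of a tabloid stands. -/
def Tabloid.row (x : Tabloid μ) : Fin μ.card → ℕ :=
  Quotient.lift (s := rowSetoid μ) Tableau.rowOf (fun _ _ h => h) x

@[simp]
theorem Tabloid.row_tabloid (a : Tableau μ) : a.tabloid.row = a.rowOf := rfl

theorem Tabloid.row_injective : Function.Injective (Tabloid.row (μ := μ)) := by
  intro x y
  refine Quotient.inductionOn₂ x y fun a b h => Quotient.sound (s := rowSetoid μ) h

theorem Tabloid.ext_row {x y : Tabloid μ} (h : ∀ k, x.row k = y.row k) : x = y :=
  Tabloid.row_injective (funext h)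

theorem Tabloid.exists_tableau (x : Tabloid μ) : ∃ a : Tableau μ, a.tabloid = x :=
  Quotient.exists_rep x

instance : Finite (Tabloid μ) := Quotient.finite _

instance : MulAction (Perm (Fin μ.card)) (Tabloid μ) where
  smul σ x := Quotient.map (sa := rowSetoid μ) (sb := rowSetoid μ) (fun a => a.act σ)
    (fun _ _ h => funext fun k => congrFun h (σ⁻¹ k)) x
  one_smul x := Quotient.inductionOn x fun _ => rfl
  mul_smul _ _ x := Quotient.inductionOn x fun _ => rfl

theorem smul_tabloid (σ : Perm (Fin μ.card)) (a : Tableau μ) :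
    σ • a.tabloid = (a.act σ).tabloid := rfl

@[simp]
theorem Tabloid.row_smul (σ : Perm (Fin μ.card)) (x : Tabloid μ) (k : Fin μ.card) :
    (σ • x).row k = x.row (σ⁻¹ k) := by
  obtain ⟨a, rfl⟩ := x.exists_tableau
  rfl

theorem exists_smul_eq (x y : Tabloid μ) : ∃ σ : Perm (Fin μ.card), y = σ • x := by
  obtain ⟨a, rfl⟩ := x.exists_tableau
  obtain ⟨b, rfl⟩ := y.exists_tableau
  refine ⟨a.symm.trans b, ?_⟩
  rw [smul_tabloid]
  congr 1
  ext c
  simp [Tableau.act]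

theorem Tableau.card_row (a : Tableau μ) (r : ℕ) :
    (Finset.univ.filter fun k => a.rowOf k = r).card = μ.rowLen r := by
  rw [← Finset.card_range (μ.rowLen r)]
  refine Finset.card_nbij a.colOf ?_ ?_ ?_
  · intro k hk
    simp only [Finset.coe_filter, Finset.mem_univ, true_and, Set.mem_ofPred_eq] at hk
    have := a.colOf_lt k
    rw [hk] at this
    simpa using this
  · intro k hk l hl h
    simp only [Finset.coe_filter, Finset.mem_univ, true_and, Set.mem_ofPred_eq] at hk hl
    exact a.eq_of_cell_eq (hk.trans hl.symm) h
  · intro c hc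
    rw [Finset.mem_coe, Finset.mem_range] at hc
    obtain ⟨k, hk, hk'⟩ := a.exists_entry (YoungDiagram.mem_iff_lt_rowLen.2 hc)
    exact ⟨k, by simpa using hk, hk'⟩

theorem Tabloid.card_row (x : Tabloid μ) (r : ℕ) :
    (Finset.univ.filter fun k => x.row k = r).card = μ.rowLen r := by
  obtain ⟨a, rfl⟩ := x.exists_tableau
  exact a.card_row r

theorem Tabloid.card_row_lt (x : Tabloid μ) (a : Tableau μ) (r : ℕ) :
    (Finset.univ.filter fun k => x.row k < r).card =
      (Finset.univ.filter fun k => a.rowOf k < r).card := by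
  obtain ⟨σ, rfl⟩ := exists_smul_eq a.tabloid x
  refine Finset.card_nbij' (fun k => σ⁻¹ k) (fun k => σ k) ?_ ?_ ?_ ?_ <;>
    simp [Set.MapsTo, Set.LeftInvOn]

/-- If the entries of each column of `a` lie in different rows of `x`, then `x` arises from `a` by a
permutation of the columns. -/
theorem exists_column_perm (a : Tableau μ) (x : Tabloid μ)
    (h : ∀ k l, a.colOf k = a.colOf l → x.row k = x.row l → k = l) :
    ∃ q : Perm (Fin μ.card), (∀ k, a.colOf (q k) = a.colOf k) ∧ x = q • a.tabloid := by
  classical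
  -- Count the entries in the first r rows column by column. Column c contributes at most min(r,
  -- colLen c) for `x`, and exactly that for `a`. The totals agree because the row lengths do, so
  -- equality holds in every column; for the column of `k`, which has length r, this puts all its
  -- entries in the first r rows of `x`.
  have hlt : ∀ k, x.row k < μ.colLen (a.colOf k) := by
    intro k
    set r := μ.colLen (a.colOf k) with hr
    have hmaps : ∀ (y : Fin μ.card → ℕ), ∀ l ∈ Finset.univ.filter (fun l => y l < r),
        a.colOf l ∈ Finset.univ.image a.colOf := fun y l _ =>
      Finset.mem_image_of_mem _ (Finset.mem_univ l)
    have hle : ∀ c ∈ Finset.univ.image a.colOf,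
        ((Finset.univ.filter fun l => x.row l < r).filter fun l => a.colOf l = c).card ≤
        ((Finset.univ.filter fun l => a.rowOf l < r).filter fun l => a.colOf l = c).card := by
      intro c _
      have e : ((Finset.univ.filter fun l => a.rowOf l < r).filter fun l => a.colOf l = c).card =
          min r (μ.colLen c) := by
        rw [← Finset.card_range (min r (μ.colLen c))]
        refine Finset.card_nbij a.rowOf ?_ ?_ ?_
        · intro l hl
          simp only [Finset.coe_filter, Finset.mem_filter, Finset.mem_univ, true_and,
            Set.mem_ofPred_eq] at hl
          have := a.rowOf_lt l
          rw [hl.2] at this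
          simp [hl.1, this]
        · intro l hl l' hl' he
          simp only [Finset.coe_filter, Finset.mem_filter, Finset.mem_univ, true_and,
            Set.mem_ofPred_eq] at hl hl'
          exact a.eq_of_cell_eq he (hl.2.trans hl'.2.symm)
        · intro i hi
          rw [Finset.mem_coe, Finset.mem_range, lt_min_iff] at hi
          obtain ⟨l, hl, hl'⟩ := a.exists_entry (YoungDiagram.mem_iff_lt_colLen.2 hi.2)
          exact ⟨l, by simp [hl, hl', hi.1], hl⟩
      rw [e, le_min_iff]
      constructor
      · rw [← Finset.card_range r]
        refine Finset.card_le_card_of_injOn x.row ?_ ?_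
        · intro l hl
          simp only [Finset.coe_filter, Finset.mem_filter, Finset.mem_univ, true_and,
            Set.mem_ofPred_eq] at hl
          simpa using hl.1
        · intro l hl l' hl' he
          simp only [Finset.coe_filter, Finset.mem_filter, Finset.mem_univ, true_and,
            Set.mem_ofPred_eq] at hl hl'
          exact h _ _ (hl.2.trans hl'.2.symm) he
      · rw [← Finset.card_range (μ.colLen c)]
        refine Finset.card_le_card_of_injOn a.rowOf ?_ ?_
        · intro l hl
          simp only [Finset.coe_filter, Finset.mem_filter, Finset.mem_univ, true_and,
            Set.mem_ofPred_eq] at hl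
          have := a.rowOf_lt l
          rw [hl.2] at this
          simpa using this
        · intro l hl l' hl' he
          simp only [Finset.coe_filter, Finset.mem_filter, Finset.mem_univ, true_and,
            Set.mem_ofPred_eq] at hl hl'
          exact a.eq_of_cell_eq he (hl.2.trans hl'.2.symm)
    have hsum := x.card_row_lt a r
    rw [Finset.card_eq_sum_card_fiberwise (hmaps x.row),
      Finset.card_eq_sum_card_fiberwise (hmaps a.rowOf)] at hsum
    have heq := (Finset.sum_eq_sum_iff_of_le hle).1 hsum (a.colOf k)
      (Finset.mem_image_of_mem _ (Finset.mem_univ k))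
    have hsub : (Finset.univ.filter fun l => a.rowOf l < r).filter (fun l => a.colOf l = a.colOf k) =
        Finset.univ.filter fun l => a.colOf l = a.colOf k := by
      ext l
      simp only [Finset.mem_filter, Finset.mem_univ, true_and, and_iff_right_iff_imp]
      intro hl
      have := a.rowOf_lt l
      rwa [hl] at this
    rw [hsub] at heq
    have := Finset.eq_of_subset_of_card_le
      (s := (Finset.univ.filter fun l => x.row l < r).filter fun l => a.colOf l = a.colOf k)
      (t := Finset.univ.filter fun l => a.colOf l = a.colOf k)
      (fun l hl => by
        simp only [Finset.mem_filter, Finset.mem_univ, true_and] at hl ⊢; exact hl.2) heq.ge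
    have hk : k ∈ Finset.univ.filter fun l => a.colOf l = a.colOf k := by simp
    rw [← this] at hk
    simp only [Finset.mem_filter, Finset.mem_univ, true_and, and_true] at hk
    exact hk
  -- `p k` is the entry of `a` in the column of `k` and in the row where `x` has `k`; the required
  -- permutation is the inverse of `p`.
  choose p hp hp' using fun k => a.exists_entry (YoungDiagram.mem_iff_lt_colLen.2 (hlt k))
  have hinj : Function.Injective p := by
    intro k l hkl
    refine h k l ?_ ?_
    · rw [← hp' k, ← hp' l, hkl]
    · rw [← hp k, ← hp l, hkl]
  set P : Perm (Fin μ.card) := Equiv.ofBijective p (Finite.injective_iff_bijective.1 hinj) with hP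
  have hPp : ∀ k, P k = p k := fun k => rfl
  refine ⟨P⁻¹, fun k => ?_, Tabloid.ext_row fun k => ?_⟩
  · rw [← hp' (P⁻¹ k), ← hPp]
    simp
  · rw [Tabloid.row_smul, inv_inv, hPp, Tabloid.row_tabloid, hp]

/-! #### The permutation representation and the form -/

/-- The action of the symmetric group on `M^μ`. -/
noncomputable def permRep (μ : YoungDiagram) :
    Perm (Fin μ.card) →* Module.End ℤ (PermModule μ) where
  toFun σ := Finsupp.lmapDomain ℤ ℤ (σ • ·)
  map_one' := by ext; simp
  map_mul' σ τ := by ext; simp [mul_smul]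

@[simp]
theorem permRep_single (σ : Perm (Fin μ.card)) (x : Tabloid μ) (c : ℤ) :
    permRep μ σ (Finsupp.single x c) = Finsupp.single (σ • x) c := by
  simp [permRep]

@[simp]
theorem permRep_apply (σ : Perm (Fin μ.card)) (v : PermModule μ) (x : Tabloid μ) :
    permRep μ σ v x = v (σ⁻¹ • x) := by
  conv_lhs => rw [← smul_inv_smul σ x]
  exact Finsupp.mapDomain_apply (MulAction.injective σ) _ _

theorem form_single_left (x : Tabloid μ) (v : PermModule μ) :
    form μ (Finsupp.single x 1) v = v x := by
  simp [form]

theorem form_comm (u v : PermModule μ) : form μ u v = form μ v u := by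
  classical
  have h : form μ = (form μ).flip := by
    refine Finsupp.lhom_ext' fun x => LinearMap.ext_ring (Finsupp.lhom_ext' fun y =>
      LinearMap.ext_ring ?_)
    change form μ (Finsupp.single x 1) (Finsupp.single y 1) =
      form μ (Finsupp.single y 1) (Finsupp.single x 1)
    rw [form_single, form_single]
    simp only [eq_comm]
  exact congrFun (congrArg DFunLike.coe (congrFun (congrArg DFunLike.coe h) u)) v

theorem form_single_right (x : Tabloid μ) (v : PermModule μ) :
    form μ v (Finsupp.single x 1) = v x := by
  rw [form_comm, form_single_left]

theorem form_permRep (σ : Perm (Fin μ.card)) (u v : PermModule μ) :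
    form μ (permRep μ σ u) v = form μ u (permRep μ σ⁻¹ v) := by
  induction u using Finsupp.induction_linear with
  | zero => simp
  | add u u' h h' => rw [map_add, map_add, map_add, LinearMap.add_apply, LinearMap.add_apply, h, h']
  | single x c =>
    rw [← mul_one c, ← smul_eq_mul, ← Finsupp.smul_single, map_smul, map_smul, map_smul,
      LinearMap.smul_apply, LinearMap.smul_apply, permRep_single, form_single_left,
      form_single_left, permRep_apply, inv_inv]

/-- The adjoint of a permutation is its inverse, and a character with values ±1 takes the same value
on both. -/
theorem form_symm {α : Type*} (χ : Perm (Fin μ.card) →* ℤˣ) (g : Fin μ.card → α)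
    (u v : PermModule μ) :
    form μ (symm (permRep μ) χ g u) v = form μ u (symm (permRep μ) χ g v) := by
  rw [symm_apply, symm_apply, map_sum, map_sum, LinearMap.sum_apply]
  refine Finset.sum_bij' (fun σ _ => σ⁻¹) (fun σ _ => σ⁻¹) (fun σ => inv_mem_stab)
    (fun σ => inv_mem_stab) (by simp) (by simp) ?_
  intro σ _
  rw [map_smul, map_smul, LinearMap.smul_apply, form_permRep, map_inv χ, units_inv]

/-- Two entries of `K` stand in the same row of `x`, so antisymmetrizing over `K` kills `x`. -/
theorem symm_sign_single_eq_zero {α : Type*} {g : Fin μ.card → α} {x : Tabloid μ}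
    {k l : Fin μ.card} (hkl : k ≠ l) (hg : g k = g l) (hx : x.row k = x.row l) :
    symm (permRep μ) Perm.sign g (Finsupp.single x 1) = 0 := by
  refine symm_eq_zero (swap_mem_stab hg) ?_
  have : swap k l • x = x := by
    refine Tabloid.ext_row fun m => ?_
    rw [Tabloid.row_smul, swap_inv, swap_apply_def]
    split_ifs with h1 h2
    · rw [h1, hx]
    · rw [h2, hx]
    · rfl
  simp [this, Perm.sign_swap hkl]

/-! #### Polytabloids -/

/-- The entries of `a` in the rows from `i` on. -/
def Tableau.lower (a : Tableau μ) (i : ℕ) : Finset (Fin μ.card) := {k | i ≤ a.rowOf k}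

theorem Tableau.mem_lower {a : Tableau μ} {i : ℕ} {k : Fin μ.card} :
    k ∈ a.lower i ↔ i ≤ a.rowOf k := by simp [Tableau.lower]

/-- The signed column symmetrizer of the rows of `a` from `i` on. -/
noncomputable def Tableau.colSym (a : Tableau μ) (i : ℕ) : Module.End ℤ (PermModule μ) :=
  symm (permRep μ) Perm.sign (inside (a.lower i) a.colOf)

/-- The row symmetrizer of the rows of `a` from `i` on. -/
noncomputable def Tableau.rowSym (a : Tableau μ) (i : ℕ) : Module.End ℤ (PermModule μ) :=
  symm (permRep μ) 1 (inside (a.lower i) a.rowOf)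

/-- The polytabloid of the rows of `a` from `i` on, the other rows being kept. -/
noncomputable def Tableau.poly (a : Tableau μ) (i : ℕ) : PermModule μ :=
  a.colSym i (Finsupp.single a.tabloid 1)

theorem mem_stab_col {a : Tableau μ} {i : ℕ} {σ : Perm (Fin μ.card)} :
    σ ∈ stab (inside (a.lower i) a.colOf) ↔
      (∀ k, a.colOf (σ k) = a.colOf k) ∧ ∀ k, a.rowOf k < i → σ k = k := by
  rw [mem_stab_inside, mem_stab]
  simp [Tableau.mem_lower]

theorem mem_stab_row {a : Tableau μ} {i : ℕ} {σ : Perm (Fin μ.card)} :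
    σ ∈ stab (inside (a.lower i) a.rowOf) ↔
      (∀ k, a.rowOf (σ k) = a.rowOf k) ∧ ∀ k, a.rowOf k < i → σ k = k := by
  rw [mem_stab_inside, mem_stab]
  simp [Tableau.mem_lower]

theorem polytabloid_eq (a : Tableau μ) : polytabloid a = a.poly 0 := by
  classical
  rw [Tableau.poly, Tableau.colSym, symm_apply, polytabloid]
  refine Finset.sum_congr ?_ fun σ _ => ?_
  · ext σ
    rw [mem_stab_col]
    simp only [Finset.mem_filter, Finset.mem_univ, true_and, Nat.not_lt_zero, false_implies,
      implies_true, and_true]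
    rfl
  · rw [permRep_single, smul_tabloid]
    simp

theorem poly_apply_smul {a : Tableau μ} {i : ℕ} {q : Perm (Fin μ.card)}
    (hq : q ∈ stab (inside (a.lower i) a.colOf)) :
    a.poly i (q • a.tabloid) = ((Perm.sign q : ℤˣ) : ℤ) := by
  classical
  rw [Tableau.poly, Tableau.colSym, symm_apply, Finsupp.finsetSum_apply,
    Finset.sum_eq_single_of_mem q hq]
  · simp
  · intro σ hσ hne
    rw [permRep_single, Finsupp.smul_apply, Finsupp.single_apply, if_neg, smul_zero]
    intro h
    apply hne
    rw [mem_stab_col] at hσ hq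
    have h1 : σ⁻¹ = q⁻¹ := by
      ext k
      have hr := congrFun (congrArg Tabloid.row h) k
      rw [Tabloid.row_smul, Tabloid.row_smul] at hr
      have hc : a.colOf (σ⁻¹ k) = a.colOf (q⁻¹ k) := by
        rw [← hσ.1, ← hq.1 (q⁻¹ k)]
        simp
      rw [a.eq_of_cell_eq hr hc]
    simpa using congrArg (·⁻¹) h1

theorem poly_apply_self (a : Tableau μ) (i : ℕ) : a.poly i a.tabloid = 1 := by
  simpa using poly_apply_smul (a := a) (one_mem_stab (inside (a.lower i) a.colOf))

theorem exists_of_poly_apply_ne_zero {a : Tableau μ} {i : ℕ} {x : Tabloid μ} (h : a.poly i x ≠ 0) :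
    ∃ q ∈ stab (inside (a.lower i) a.colOf), x = q • a.tabloid := by
  classical
  rw [Tableau.poly, Tableau.colSym, symm_apply, Finsupp.finsetSum_apply] at h
  obtain ⟨q, hq, hne⟩ := Finset.exists_ne_zero_of_sum_ne_zero h
  refine ⟨q, hq, ?_⟩
  by_contra hx
  rw [permRep_single, Finsupp.smul_apply, Finsupp.single_apply, if_neg (fun h => hx h.symm),
    smul_zero] at hne
  exact hne rfl

theorem perm_poly {a : Tableau μ} {i : ℕ} {q : Perm (Fin μ.card)}
    (hq : q ∈ stab (inside (a.lower i) a.colOf)) :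
    permRep μ q (a.poly i) = ((Perm.sign q : ℤˣ) : ℤ) • a.poly i :=
  perm_symm hq _

/-- Each of the first i rows of `a` is contained in the same row of `x`, and both have the same
length. -/
theorem rowOf_eq_of_row_lt {a : Tableau μ} {i : ℕ} {x : Tabloid μ}
    (hx : ∀ k, a.rowOf k < i → x.row k = a.rowOf k) {l : Fin μ.card} (hl : x.row l < i) :
    a.rowOf l = x.row l := by
  have hsub : (Finset.univ.filter fun k => a.rowOf k = x.row l) ⊆
      Finset.univ.filter fun k => x.row k = x.row l := by
    intro k hk
    simp only [Finset.mem_filter, Finset.mem_univ, true_and] at hk ⊢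
    rw [hx k (hk ▸ hl), hk]
  have heq := Finset.eq_of_subset_of_card_le hsub (by rw [a.card_row, x.card_row])
  have hl' : l ∈ Finset.univ.filter fun k => x.row k = x.row l := by simp
  rw [← heq] at hl'
  simpa using hl'

/-- The sign lemma: a column symmetrizer maps `M^μ` to the multiples of the polytabloid. -/
theorem colSym_single (a : Tableau μ) (i : ℕ) (x : Tabloid μ)
    (hx : ∀ k, a.rowOf k < i → x.row k = a.rowOf k) :
    a.colSym i (Finsupp.single x 1) = a.poly i x • a.poly i := by
  by_cases h : ∀ k l, a.colOf k = a.colOf l → x.row k = x.row l → k = l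
  · obtain ⟨q, hq, rfl⟩ := exists_column_perm a x h
    have hq' : q ∈ stab (inside (a.lower i) a.colOf) := by
      refine mem_stab_col.2 ⟨hq, fun k hk => ?_⟩
      have h1 := hx k hk
      rw [Tabloid.row_smul, Tabloid.row_tabloid] at h1
      have h2 : q⁻¹ k = k := a.eq_of_cell_eq h1 (by
        rw [← hq (q⁻¹ k)]
        simp)
      exact (Perm.inv_eq_iff_eq.1 h2).symm
    rw [poly_apply_smul hq', ← permRep_single, Tableau.colSym, symm_perm hq']
    rfl
  · push Not at h
    obtain ⟨k, l, hc, hr, hne⟩ := h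
    have hlow : ∀ m, x.row m < i → ∀ m', a.colOf m = a.colOf m' → x.row m = x.row m' → m = m' := by
      intro m hm m' hc hr
      refine a.eq_of_cell_eq ?_ hc
      rw [rowOf_eq_of_row_lt hx hm, rowOf_eq_of_row_lt hx (hr ▸ hm), hr]
    have hxi : i ≤ x.row k := not_lt.1 fun h1 => hne (hlow k h1 l hc hr)
    have hi : ∀ m, i ≤ x.row m → m ∈ a.lower i := by
      intro m hm
      rw [Tableau.mem_lower]
      by_contra h1
      push Not at h1
      rw [hx m h1] at hm
      omega
    have hz : a.poly i x = 0 := by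
      by_contra h0
      obtain ⟨q, hq, rfl⟩ := exists_of_poly_apply_ne_zero h0
      rw [mem_stab_col] at hq
      rw [Tabloid.row_smul, Tabloid.row_smul] at hr
      have hcol : ∀ m, a.colOf (q⁻¹ m) = a.colOf m := fun m => by
        rw [← hq.1 (q⁻¹ m)]
        simp
      have := a.eq_of_cell_eq (k := q⁻¹ k) (l := q⁻¹ l) hr (by rw [hcol, hcol, hc])
      exact hne (by simpa using this)
    rw [hz, zero_smul]
    refine symm_sign_single_eq_zero hne ?_ hr
    rw [inside, inside, if_pos (hi k hxi), if_pos (hi l (hr ▸ hxi)), hc]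

/-- On vectors that agree with `a` above row i the column symmetrizer has rank at most one, which
turns operator identities into scalars. -/
theorem colSym_apply (a : Tableau μ) (i : ℕ) (u : PermModule μ)
    (hu : ∀ x, u x ≠ 0 → ∀ k, a.rowOf k < i → x.row k = a.rowOf k) :
    a.colSym i u = form μ u (a.poly i) • a.poly i := by
  have h1 : u = ∑ x ∈ u.support, u x • Finsupp.single x (1 : ℤ) := by
    conv_lhs => rw [← Finsupp.sum_single u]
    simp [Finsupp.sum]
  rw [h1, map_sum, map_sum, LinearMap.sum_apply, Finset.sum_smul]
  refine Finset.sum_congr rfl fun x hx => ?_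
  rw [map_smul, map_smul, LinearMap.smul_apply, form_single_left,
    colSym_single a i x (hu x (Finsupp.mem_support_iff.1 hx)), smul_assoc]

end Specht

/-! ### The hook formula for the norm of a polytabloid -/

namespace Specht

open Equiv YoungSymm

variable {μ : YoungDiagram}

theorem eq_sum_single (u : PermModule μ) :
    u = ∑ x ∈ u.support, u x • Finsupp.single x (1 : ℤ) := by
  conv_lhs => rw [← Finsupp.sum_single u]
  simp [Finsupp.sum]

theorem symm_sign_eq_zero_of_rows {K : Finset (Fin μ.card)} {v : PermModule μ}
    (hv : ∀ x, v x ≠ 0 → ∃ k ∈ K, ∃ l ∈ K, k ≠ l ∧ x.row k = x.row l) :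
    symm (permRep μ) Perm.sign (onSet K) v = 0 := by
  rw [eq_sum_single v, map_sum]
  refine Finset.sum_eq_zero fun x hx => ?_
  obtain ⟨k, hk, l, hl, hne, h⟩ := hv x (Finsupp.mem_support_iff.1 hx)
  rw [map_smul, symm_sign_single_eq_zero hne _ h, smul_zero]
  rw [onSet, onSet, if_pos hk, if_pos hl]

theorem symm_apply_apply {α : Type*} {χ : Perm (Fin μ.card) →* ℤˣ} {g : Fin μ.card → α}
    (v : PermModule μ) (x : Tabloid μ) :
    symm (permRep μ) χ g v x = ∑ σ ∈ stab g, ((χ σ : ℤˣ) : ℤ) * v (σ⁻¹ • x) := by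
  rw [symm_apply, Finsupp.finsetSum_apply]
  simp

theorem exists_of_symm_apply_ne_zero {α : Type*} {χ : Perm (Fin μ.card) →* ℤˣ}
    {g : Fin μ.card → α} {v : PermModule μ} {x : Tabloid μ}
    (h : symm (permRep μ) χ g v x ≠ 0) : ∃ σ ∈ stab g, v (σ⁻¹ • x) ≠ 0 := by
  rw [symm_apply_apply] at h
  obtain ⟨σ, hσ, hne⟩ := Finset.exists_ne_zero_of_sum_ne_zero h
  exact ⟨σ, hσ, right_ne_zero_of_mul hne⟩

/-! ### Vectors satisfying the relations of the rows from i on -/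

/-- The vectors supported on tabloids that agree with `a` above row `i`, and killed by the
symmetrizers of more than `μ.rowLen i` entries below. -/
noncomputable def Tableau.lowerModule (a : Tableau μ) (i : ℕ) : Submodule ℤ (PermModule μ) where
  carrier := {v | (∀ x, v x ≠ 0 → ∀ k, a.rowOf k < i → x.row k = a.rowOf k) ∧
    ∀ K ⊆ a.lower i, μ.rowLen i < K.card → symm (permRep μ) 1 (onSet K) v = 0}
  zero_mem' := ⟨fun x h => absurd rfl h, fun K _ _ => map_zero _⟩
  add_mem' := by
    rintro u v ⟨hu, hu'⟩ ⟨hv, hv'⟩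
    refine ⟨fun x hx k hk => ?_, fun K hK hc => ?_⟩
    · by_cases h : u x = 0
      · refine hv x (fun h' => hx ?_) k hk
        rw [Finsupp.add_apply, h, h', add_zero]
      · exact hu x h k hk
    · rw [map_add, hu' K hK hc, hv' K hK hc, add_zero]
  smul_mem' := by
    rintro c v ⟨hv, hv'⟩
    refine ⟨fun x hx k hk => hv x (fun h => hx ?_) k hk, fun K hK hc => ?_⟩
    · rw [Finsupp.smul_apply, h, smul_zero]
    · rw [map_smul, hv' K hK hc, smul_zero]

/-- Conjugation carries the symmetrizer of `K` to that of another subset of the lower entries of the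
same size. -/
theorem perm_mem_lowerModule {a : Tableau μ} {i : ℕ} {σ : Perm (Fin μ.card)}
    (hσ : ∀ k, a.rowOf k < i → σ k = k) {v : PermModule μ} (hv : v ∈ a.lowerModule i) :
    permRep μ σ v ∈ a.lowerModule i := by
  classical
  have hσ' : ∀ k, a.rowOf k < i → σ⁻¹ k = k := fun k hk => by
    rw [Perm.inv_eq_iff_eq, hσ k hk]
  refine ⟨fun x hx k hk => ?_, fun K hK hc => ?_⟩
  · rw [permRep_apply] at hx
    have := hv.1 _ hx k hk
    rwa [Tabloid.row_smul, inv_inv, hσ k hk] at this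
  · have h := hv.2 (K.map (σ⁻¹ : Perm (Fin μ.card)).toEmbedding) ?_ (by rwa [Finset.card_map])
    · have h1 := perm_symm_conj (π := permRep μ) (χ := 1)
        (g := onSet (K.map (σ⁻¹ : Perm (Fin μ.card)).toEmbedding)) σ v
      rw [h, map_zero] at h1
      rw [h1]
      refine congrFun (congrArg DFunLike.coe (symm_congr ?_)) _
      have hmem : ∀ k, σ⁻¹ k ∈ K.map (σ⁻¹ : Perm (Fin μ.card)).toEmbedding ↔ k ∈ K :=
        fun k => Finset.mem_map' (σ⁻¹ : Perm (Fin μ.card)).toEmbedding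
      ext τ
      rw [mem_stab_onSet, mem_stab]
      constructor
      · intro h k
        by_cases hk : k ∈ K
        · have hk' : τ k ∈ K := apply_mem_of_mem_stab_onSet (mem_stab_onSet.2 h) hk
          simp only [onSet, hmem, hk, hk', if_true]
        · rw [h k hk]
      · intro h k hk
        have := h k
        rw [onSet, onSet, if_neg (mt (hmem k).1 hk)] at this
        split_ifs at this
        simpa using this
    · intro k hk
      obtain ⟨l, hl, rfl⟩ := Finset.mem_map.1 hk
      have hl' := Tableau.mem_lower.1 (hK hl)
      rw [Tableau.mem_lower]
      by_contra h1
      push Not at h1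
      have h2 := hσ _ h1
      simp only [Equiv.coe_toEmbedding] at h1 h2
      rw [← Perm.mul_apply, mul_inv_cancel, Perm.one_apply] at h2
      rw [← h2] at h1
      omega

theorem symm_mem_lowerModule {a : Tableau μ} {i : ℕ} {α : Type*} {χ : Perm (Fin μ.card) →* ℤˣ}
    {g : Fin μ.card → α} (hg : ∀ σ ∈ stab g, ∀ k, a.rowOf k < i → σ k = k) {v : PermModule μ}
    (hv : v ∈ a.lowerModule i) : symm (permRep μ) χ g v ∈ a.lowerModule i := by
  rw [symm_apply]
  exact Submodule.sum_mem _ fun σ hσ =>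
    Submodule.smul_mem _ _ (perm_mem_lowerModule (hg σ hσ) hv)

/-- By pigeonhole two entries of `K` share a column of `a`; their transposition negates the
polytabloid but is absorbed by the symmetrizer. -/
theorem poly_mem_lowerModule (a : Tableau μ) (i : ℕ) : a.poly i ∈ a.lowerModule i := by
  refine ⟨fun x hx k hk => ?_, fun K hK hc => ?_⟩
  · obtain ⟨q, hq, rfl⟩ := exists_of_poly_apply_ne_zero hx
    rw [Tabloid.row_smul, Tabloid.row_tabloid]
    rw [mem_stab_col] at hq
    rw [Perm.inv_eq_iff_eq.2 (hq.2 k hk).symm]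
  · obtain ⟨k, hk, l, hl, hne, hkl⟩ := Finset.exists_ne_map_eq_of_card_lt_of_maps_to
      (s := K) (t := Finset.range (μ.rowLen i)) (by simpa using hc) (f := a.colOf) (by
        intro k hk
        have h1 := a.colOf_lt k
        have h2 := μ.rowLen_anti _ _ (Tableau.mem_lower.1 (hK hk))
        simp only [Finset.coe_range, Set.mem_Iio]
        omega)
    refine symm_eq_zero (τ := swap k l) (swap_mem_stab ?_) ?_
    · rw [onSet, onSet, if_pos hk, if_pos hl]
    · rw [perm_poly]
      · simp [Perm.sign_swap hne]
      · refine swap_mem_stab ?_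
        rw [inside, inside, if_pos (hK hk), if_pos (hK hl), hkl]

/-- The entries of `a` in row `i` and the columns from `j` on. -/
def Tableau.rowFrom (a : Tableau μ) (i j : ℕ) : Finset (Fin μ.card) :=
  {k | a.rowOf k = i ∧ j ≤ a.colOf k}

theorem Tableau.mem_rowFrom {a : Tableau μ} {i j : ℕ} {k : Fin μ.card} :
    k ∈ a.rowFrom i j ↔ a.rowOf k = i ∧ j ≤ a.colOf k := by simp [Tableau.rowFrom]

theorem Tableau.card_rowFrom (a : Tableau μ) (i j : ℕ) :
    (a.rowFrom i j).card = μ.rowLen i - j := by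
  rw [← Nat.card_Ico]
  refine Finset.card_nbij a.colOf ?_ ?_ ?_
  · intro k hk
    rw [Finset.mem_coe, Tableau.mem_rowFrom] at hk
    have := a.colOf_lt k
    rw [hk.1] at this
    simp [this, hk.2]
  · intro k hk l hl h
    rw [Finset.mem_coe, Tableau.mem_rowFrom] at hk hl
    exact a.eq_of_cell_eq (hk.1.trans hl.1.symm) h
  · intro c hc
    rw [Finset.mem_coe, Finset.mem_Ico] at hc
    obtain ⟨k, hk, hk'⟩ := a.exists_entry (YoungDiagram.mem_iff_lt_rowLen.2 hc.2)
    exact ⟨k, by rw [Finset.mem_coe, Tableau.mem_rowFrom, hk, hk']; exact ⟨rfl, hc.1⟩, hk'⟩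

/-- The entries of `a` in column `j` and the rows from `i` on. -/
def Tableau.colFrom (a : Tableau μ) (i j : ℕ) : Finset (Fin μ.card) :=
  {k | a.colOf k = j ∧ i ≤ a.rowOf k}

theorem Tableau.mem_colFrom {a : Tableau μ} {i j : ℕ} {k : Fin μ.card} :
    k ∈ a.colFrom i j ↔ a.colOf k = j ∧ i ≤ a.rowOf k := by simp [Tableau.colFrom]

theorem Tableau.card_colFrom (a : Tableau μ) (i j : ℕ) :
    (a.colFrom i j).card = μ.colLen j - i := by
  rw [← Nat.card_Ico]
  refine Finset.card_nbij a.rowOf ?_ ?_ ?_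
  · intro k hk
    rw [Finset.mem_coe, Tableau.mem_colFrom] at hk
    have := a.rowOf_lt k
    rw [hk.1] at this
    simp [this, hk.2]
  · intro k hk l hl h
    rw [Finset.mem_coe, Tableau.mem_colFrom] at hk hl
    exact a.eq_of_cell_eq h (hk.1.trans hl.1.symm)
  · intro r hr
    rw [Finset.mem_coe, Finset.mem_Ico] at hr
    obtain ⟨k, hk, hk'⟩ := a.exists_entry (YoungDiagram.mem_iff_lt_colLen.2 hr.2)
    exact ⟨k, by rw [Finset.mem_coe, Tableau.mem_colFrom, hk, hk']; exact ⟨rfl, hr.1⟩, hk⟩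

/-- A vector that satisfies the Garnir relations for row `i` is determined by its coefficients at
the tabloids having the same row `i` as `a`. -/
theorem eq_zero_of_row_relations (a : Tableau μ) (i : ℕ) (w : PermModule μ)
    (hs : ∀ x, w x ≠ 0 → ∀ k, a.rowOf k < i → x.row k = a.rowOf k)
    (hb : ∀ b, i < a.rowOf b → ∀ x, w x + ∑ k ∈ a.rowFrom i 0, w (swap b k • x) = 0)
    (h0 : ∀ x, (∀ k, a.rowOf k = i → x.row k = i) → w x = 0) : w = 0 := by
  -- Induction on the number of entries of row i of `a` that are not in row i of `x`.
  have key : ∀ (n : ℕ) (x : Tabloid μ),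
      ((a.rowFrom i 0).filter fun k => x.row k ≠ i).card = n → w x = 0 := by
    intro n
    induction n using Nat.strong_induction_on with
    | _ n ih =>
      intro x hn
      by_cases hall : ∀ k, a.rowOf k = i → x.row k = i
      · exact h0 x hall
      by_contra hw
      have hx := hs x hw
      obtain ⟨b, hb1, hb2⟩ : ∃ b, x.row b = i ∧ a.rowOf b ≠ i := by
        by_contra! hcon
        apply hall
        have hsub : (Finset.univ.filter fun k => x.row k = i) ⊆
            Finset.univ.filter fun k => a.rowOf k = i := by
          intro k hk
          simp only [Finset.mem_filter, Finset.mem_univ, true_and] at hk ⊢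
          exact hcon k hk
        have := Finset.eq_of_subset_of_card_le hsub (by rw [a.card_row, x.card_row])
        intro k hk
        have hk' : k ∈ Finset.univ.filter fun k => a.rowOf k = i := by simpa using hk
        rw [← this] at hk'
        simpa using hk'
      have hbi : i < a.rowOf b := by
        by_contra h1
        have h2 : a.rowOf b < i := by omega
        have := hx b h2
        omega
      have hsum := hb b hbi x
      -- If `k` is in row i of `x`, exchanging it with `b` changes nothing; otherwise the exchange
      -- brings `k` into row i, and induction applies. The relation becomes (1 + a count) times `w
      -- x` = 0.
      have hterm : ∀ k ∈ a.rowFrom i 0, w (swap b k • x) = if x.row k = i then w x else 0 := by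
        intro k hk
        have hki := (Tableau.mem_rowFrom.1 hk).1
        split_ifs with h
        · congr 1
          refine Tabloid.ext_row fun m => ?_
          rw [Tabloid.row_smul, swap_inv, swap_apply_def]
          split_ifs with h1 h2
          · rw [h1, h, hb1]
          · rw [h2, h, hb1]
          · rfl
        · refine ih _ ?_ _ rfl
          rw [← hn]
          refine Finset.card_lt_card ⟨fun m hm => ?_, fun hsub => ?_⟩
          · rw [Finset.mem_filter, Tabloid.row_smul, swap_inv, swap_apply_def] at hm
            rw [Finset.mem_filter]
            refine ⟨hm.1, ?_⟩
            have h3 := hm.2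
            split_ifs at h3 with h1 h2
            · exact absurd (h1 ▸ (Tableau.mem_rowFrom.1 hm.1).1) hb2
            · exact absurd hb1 h3
            · exact h3
          · have h4 := hsub (Finset.mem_filter.2 ⟨hk, h⟩)
            rw [Finset.mem_filter, Tabloid.row_smul, swap_inv, swap_apply_right] at h4
            exact h4.2 hb1
      rw [Finset.sum_congr rfl hterm, ← Finset.sum_filter, Finset.sum_const, nsmul_eq_mul] at hsum
      have : (1 + (((a.rowFrom i 0).filter fun k => x.row k = i).card : ℤ)) * w x = 0 := by
        linarith
      rcases mul_eq_zero.1 this with h | h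
      · omega
      · exact hw h
  ext x
  exact key _ x rfl

/-- A column permutation that keeps the entries of row i in row i fixes each of them. -/
theorem poly_apply_of_row {a : Tableau μ} {i : ℕ} {x : Tabloid μ}
    (hx : ∀ k, a.rowOf k = i → x.row k = i) : a.poly i x = a.poly (i + 1) x := by
  have hmono : ∀ q, q ∈ stab (inside (a.lower (i + 1)) a.colOf) →
      q ∈ stab (inside (a.lower i) a.colOf) := by
    intro q hq
    rw [mem_stab_col] at *
    exact ⟨hq.1, fun k hk => hq.2 k (by omega)⟩
  by_cases h : a.poly i x = 0
  · by_contra h1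
    obtain ⟨q, hq, rfl⟩ := exists_of_poly_apply_ne_zero (i := i + 1) (a := a) (x := x)
      (fun h2 => h1 (h.trans h2.symm))
    exact h1 (by rw [poly_apply_smul hq, poly_apply_smul (hmono q hq)])
  · obtain ⟨q, hq, rfl⟩ := exists_of_poly_apply_ne_zero h
    have hq' : q ∈ stab (inside (a.lower (i + 1)) a.colOf) := by
      rw [mem_stab_col] at *
      refine ⟨hq.1, fun k hk => ?_⟩
      by_cases hki : a.rowOf k < i
      · exact hq.2 k hki
      · have hk' : a.rowOf k = i := by omega
        have h1 := hx k hk'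
        rw [Tabloid.row_smul, Tabloid.row_tabloid] at h1
        have h2 : q⁻¹ k = k := a.eq_of_cell_eq (h1.trans hk'.symm) (by
          rw [← hq.1 (q⁻¹ k)]
          simp)
        exact (Perm.inv_eq_iff_eq.1 h2).symm
    rw [poly_apply_smul hq, poly_apply_smul hq']

/-- Permutations fixing row i pointwise preserve the set of tabloids whose row i is that of `a`. -/
theorem symm_apply_congr {α : Type*} {χ : Perm (Fin μ.card) →* ℤˣ} {g : Fin μ.card → α}
    {a : Tableau μ} {i : ℕ} (hg : ∀ σ ∈ stab g, ∀ k, a.rowOf k = i → σ k = k)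
    {u v : PermModule μ} (huv : ∀ x, (∀ k, a.rowOf k = i → x.row k = i) → u x = v x)
    {x : Tabloid μ} (hx : ∀ k, a.rowOf k = i → x.row k = i) :
    symm (permRep μ) χ g u x = symm (permRep μ) χ g v x := by
  rw [symm_apply_apply, symm_apply_apply]
  refine Finset.sum_congr rfl fun σ hσ => ?_
  rw [huv]
  intro k hk
  rw [Tabloid.row_smul, inv_inv, hg σ hσ k hk, hx k hk]

theorem symm_one_apply_of_forall {K : Finset (Fin μ.card)} {i : ℕ} {x : Tabloid μ}
    (hx : ∀ k ∈ K, x.row k = i) (v : PermModule μ) :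
    symm (permRep μ) 1 (onSet K) v x = (stab (onSet K)).card * v x := by
  rw [symm_apply_apply]
  have : ∀ σ ∈ stab (onSet K), (((1 : Perm (Fin μ.card) →* ℤˣ) σ : ℤˣ) : ℤ) * v (σ⁻¹ • x) =
      v x := by
    intro σ hσ
    rw [MonoidHom.one_apply, Units.val_one, one_mul]
    congr 1
    refine Tabloid.ext_row fun k => ?_
    rw [Tabloid.row_smul, inv_inv]
    by_cases hk : k ∈ K
    · rw [hx k hk, hx _ (apply_mem_of_mem_stab_onSet hσ hk)]
    · rw [mem_stab_onSet.1 hσ k hk]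
  rw [Finset.sum_congr rfl this]
  simp

/-! ### Passing from row i to row i + 1 -/

theorem colSym_rowSym_poly (a : Tableau μ) (i : ℕ) :
    a.colSym i (a.rowSym i (a.poly i)) =
      form μ (a.rowSym i (a.poly i)) (a.poly i) • a.poly i :=
  colSym_apply a i _ (symm_mem_lowerModule (fun _ hσ => (mem_stab_row.1 hσ).2)
    (poly_mem_lowerModule a i)).1

theorem rowSym_eq_mul (a : Tableau μ) (i : ℕ) :
    a.rowSym i = symm (permRep μ) 1 (onSet (a.rowFrom i 0)) * a.rowSym (i + 1) := by
  classical
  have hu : a.lower i = a.rowFrom i 0 ∪ a.lower (i + 1) := by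
    ext k
    rw [Finset.mem_union, Tableau.mem_lower, Tableau.mem_lower, Tableau.mem_rowFrom]
    omega
  have hd : Disjoint (a.rowFrom i 0) (a.lower (i + 1)) := by
    rw [Finset.disjoint_left]
    intro k hk hk'
    rw [Tableau.mem_lower] at hk'
    rw [Tableau.mem_rowFrom] at hk
    omega
  rw [Tableau.rowSym, hu, symm_eq_mul _ _ hd]
  · rw [Tableau.rowSym]
    congr 1
    refine symm_congr ?_
    ext σ
    rw [mem_stab_inside, mem_stab_onSet]
    refine ⟨fun h => h.2, fun h => ⟨mem_stab.2 fun k => ?_, h⟩⟩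
    by_cases hk : k ∈ a.rowFrom i 0
    · have := apply_mem_of_mem_stab_onSet (mem_stab_onSet.2 h) hk
      rw [Tableau.mem_rowFrom] at hk this
      rw [hk.1, this.1]
    · rw [h k hk]
  · intro k hk l hl
    rw [Tableau.mem_rowFrom] at *
    omega

theorem commute_row {a : Tableau μ} {i : ℕ} {α : Type*} {χ : Perm (Fin μ.card) →* ℤˣ}
    {g : Fin μ.card → α} (hg : ∀ σ ∈ stab g, ∀ k, a.rowOf k < i + 1 → σ k = k) :
    Commute (symm (permRep μ) 1 (onSet (a.rowFrom i 0))) (symm (permRep μ) χ g) := by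
  refine symm_commute fun k => ?_
  by_cases hk : k ∈ a.rowFrom i 0
  · right
    exact fun σ hσ => hg σ hσ k (by rw [Tableau.mem_rowFrom] at hk; omega)
  · left
    exact fun σ hσ => mem_stab_onSet.1 hσ k hk

/-- After symmetrizing row i, both sides obey the Garnir relations, so it suffices to compare
coefficients at tabloids with row i intact. There `a.poly i` agrees with `a.poly (i + 1)`, for which
`colSym_rowSym_poly` gives the scalar. -/
theorem row_colSym_rowSym_poly (a : Tableau μ) (i : ℕ) :
    symm (permRep μ) 1 (onSet (a.rowFrom i 0))
        (a.colSym (i + 1) (a.rowSym (i + 1) (a.poly i))) =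
      form μ (a.rowSym (i + 1) (a.poly (i + 1))) (a.poly (i + 1)) •
        symm (permRep μ) 1 (onSet (a.rowFrom i 0)) (a.poly i) := by
  set c := form μ (a.rowSym (i + 1) (a.poly (i + 1))) (a.poly (i + 1)) with hc
  set u := a.colSym (i + 1) (a.rowSym (i + 1) (a.poly i)) - c • a.poly i with hu
  have hmem : u ∈ a.lowerModule i := by
    refine Submodule.sub_mem _ (symm_mem_lowerModule ?_ (symm_mem_lowerModule ?_
      (poly_mem_lowerModule a i))) (Submodule.smul_mem _ _ (poly_mem_lowerModule a i))
    · exact fun σ hσ k hk => (mem_stab_col.1 hσ).2 k (by omega)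
    · exact fun σ hσ k hk => (mem_stab_row.1 hσ).2 k (by omega)
  have hw : symm (permRep μ) 1 (onSet (a.rowFrom i 0)) u ∈ a.lowerModule i := by
    refine symm_mem_lowerModule (fun σ hσ k hk => mem_stab_onSet.1 hσ k ?_) hmem
    rw [Tableau.mem_rowFrom]
    omega
  have h0 := eq_zero_of_row_relations a i _ hw.1 ?_ ?_
  · rwa [hu, map_sub, map_smul, sub_eq_zero] at h0
  · intro b hb x
    have hbA : b ∉ a.rowFrom i 0 := by
      rw [Tableau.mem_rowFrom]
      omega
    -- Row i together with `b` has one entry more than `μ.rowLen i`, so its symmetrizer kills `u`;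
    -- factoring it through the symmetrizer of row i yields the relation.
    have h := hmem.2 (insert b (a.rowFrom i 0)) ?_ ?_
    · rw [symm_insert hbA, Module.End.mul_apply] at h
      have h1 := congrFun (congrArg DFunLike.coe h) x
      simpa using h1
    · intro k hk
      rw [Tableau.mem_lower]
      rcases Finset.mem_insert.1 hk with rfl | hk
      · omega
      · rw [Tableau.mem_rowFrom] at hk
        omega
    · rw [Finset.card_insert_of_notMem hbA, Tableau.card_rowFrom]
      omega
  · intro x hx
    rw [symm_one_apply_of_forall (i := i) (fun k hk => hx k (Tableau.mem_rowFrom.1 hk).1)]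
    have h1 : a.colSym (i + 1) (a.rowSym (i + 1) (a.poly i)) x =
        a.colSym (i + 1) (a.rowSym (i + 1) (a.poly (i + 1))) x := by
      refine symm_apply_congr (a := a) (i := i)
        (fun σ hσ k hk => (mem_stab_col.1 hσ).2 k (by omega)) (fun y hy => ?_) hx
      exact symm_apply_congr (a := a) (i := i)
        (fun σ hσ k hk => (mem_stab_row.1 hσ).2 k (by omega)) (fun z hz => poly_apply_of_row hz) hy
    rw [hu, Finsupp.sub_apply, h1, colSym_rowSym_poly, ← hc, Finsupp.smul_apply,
      Finsupp.smul_apply, poly_apply_of_row hx, sub_self, mul_zero]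

/-- The column symmetrizer of the lower rows multiplies `a.poly i` by the order of its group. Moved
to the other side of the form, it commutes with the symmetrizer of row i, and
`row_colSym_rowSym_poly` applies. -/
theorem form_rowSym_mul_card (a : Tableau μ) (i : ℕ) :
    form μ (a.rowSym i (a.poly i)) (a.poly i) * (stab (inside (a.lower (i + 1)) a.colOf)).card =
      form μ (a.rowSym (i + 1) (a.poly (i + 1))) (a.poly (i + 1)) *
        form μ (symm (permRep μ) 1 (onSet (a.rowFrom i 0)) (a.poly i)) (a.poly i) := by
  have h1 : a.colSym (i + 1) (a.poly i) =
      (stab (inside (a.lower (i + 1)) a.colOf)).card • a.poly i := by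
    refine symm_of_forall fun σ hσ => perm_poly ?_
    rw [mem_stab_col] at *
    exact ⟨hσ.1, fun k hk => hσ.2 k (by omega)⟩
  have h2 : form μ (a.rowSym i (a.poly i)) (a.colSym (i + 1) (a.poly i)) =
      form μ (symm (permRep μ) 1 (onSet (a.rowFrom i 0))
        (a.colSym (i + 1) (a.rowSym (i + 1) (a.poly i)))) (a.poly i) := by
    have hcomm : Commute (symm (permRep μ) 1 (onSet (a.rowFrom i 0))) (a.colSym (i + 1)) :=
      commute_row fun σ hσ => (mem_stab_col.1 hσ).2
    rw [← Module.End.mul_apply _ (a.colSym (i + 1)), hcomm.eq, Module.End.mul_apply,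
      Tableau.colSym, form_symm, rowSym_eq_mul, Module.End.mul_apply]
  rw [row_colSym_rowSym_poly, h1, map_nsmul, map_smul, LinearMap.smul_apply] at h2
  rw [smul_eq_mul, nsmul_eq_mul] at h2
  rw [mul_comm, h2]

/-! ### Symmetrizing a row cell by cell -/

theorem perm_row_poly (a : Tableau μ) (i j : ℕ) {σ : Perm (Fin μ.card)}
    (hσ : σ ∈ stab (onSet (a.colFrom i j))) :
    permRep μ σ (a.poly i) = ((Perm.sign σ : ℤˣ) : ℤ) • a.poly i ∧
    permRep μ σ (symm (permRep μ) 1 (onSet (a.rowFrom i (j + 1))) (a.poly i)) =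
      ((Perm.sign σ : ℤˣ) : ℤ) •
        symm (permRep μ) 1 (onSet (a.rowFrom i (j + 1))) (a.poly i) := by
  have h1 : permRep μ σ (a.poly i) = ((Perm.sign σ : ℤˣ) : ℤ) • a.poly i := by
    refine perm_poly (mem_stab_col.2 ⟨fun k => ?_, fun k hk => ?_⟩)
    · by_cases hk : k ∈ a.colFrom i j
      · have := apply_mem_of_mem_stab_onSet hσ hk
        rw [Tableau.mem_colFrom] at this hk
        omega
      · rw [mem_stab_onSet.1 hσ k hk]
    · refine mem_stab_onSet.1 hσ k ?_
      rw [Tableau.mem_colFrom]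
      omega
  refine ⟨h1, ?_⟩
  have hc : Commute (symm (permRep μ) 1 (onSet (a.rowFrom i (j + 1)))) (permRep μ σ) := by
    refine symm_commute_perm fun k => ?_
    by_cases hk : k ∈ a.colFrom i j
    · left
      refine fun τ hτ => mem_stab_onSet.1 hτ k ?_
      rw [Tableau.mem_colFrom] at hk
      rw [Tableau.mem_rowFrom]
      omega
    · right
      exact mem_stab_onSet.1 hσ k hk
  rw [← Module.End.mul_apply, ← hc.eq, Module.End.mul_apply, h1, map_smul]

/-- The Garnir relation. -/
theorem sum_swap_row_poly (a : Tableau μ) (i j : ℕ) {b : Fin μ.card}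
    (hb : b ∈ a.rowFrom i (j + 1)) :
    ∑ y ∈ a.colFrom i j, permRep μ (swap b y)
        (symm (permRep μ) 1 (onSet (a.rowFrom i (j + 1))) (a.poly i)) =
      symm (permRep μ) 1 (onSet (a.rowFrom i (j + 1))) (a.poly i) := by
  set A := a.rowFrom i (j + 1) with hA
  set D := a.colFrom i j with hD
  set v := symm (permRep μ) 1 (onSet A) (a.poly i) with hv
  have hbD : b ∉ D := by
    rw [Tableau.mem_colFrom]
    rw [Tableau.mem_rowFrom] at hb
    omega
  -- In every tabloid occurring in `v`, the entries of `insert b D` lie in rows from i up to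
  -- `μ.colLen j` (exclusive), because they come from columns not left of j. There is one entry too
  -- many for these rows, so two of them share a row.
  have hz : symm (permRep μ) Perm.sign (onSet (insert b D)) v = 0 := by
    refine symm_sign_eq_zero_of_rows fun x hx => ?_
    obtain ⟨p, hp, hx⟩ := exists_of_symm_apply_ne_zero hx
    obtain ⟨q, hq, hx⟩ := exists_of_poly_apply_ne_zero hx
    rw [inv_smul_eq_iff] at hx
    have hcard : (Finset.Ico i (μ.colLen j)).card < (insert b D).card := by
      rw [Finset.card_insert_of_notMem hbD, Tableau.card_colFrom, Nat.card_Ico]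
      omega
    obtain ⟨k, hk, l, hl, hne, h⟩ := Finset.exists_ne_map_eq_of_card_lt_of_maps_to hcard
      (f := x.row) (by
        intro k hk
        have hk1 : i ≤ a.rowOf k ∧ j ≤ a.colOf k := by
          rcases Finset.mem_insert.1 hk with rfl | hk
          · rw [Tableau.mem_rowFrom] at hb
            omega
          · rw [Tableau.mem_colFrom] at hk
            omega
        have hk2 : i ≤ a.rowOf (p⁻¹ k) ∧ j ≤ a.colOf (p⁻¹ k) := by
          by_cases hkA : k ∈ A
          · have := apply_mem_of_mem_stab_onSet (inv_mem_stab hp) hkA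
            rw [Tableau.mem_rowFrom] at this
            omega
          · rw [mem_stab_onSet.1 (inv_mem_stab hp) k hkA]
            exact hk1
        have hq' := inv_mem_stab hq
        have hk3 := apply_mem_of_mem_stab_inside hq' (Tableau.mem_lower.2 hk2.1)
        rw [mem_stab_col] at hq'
        have hk4 := hq'.1 (p⁻¹ k)
        rw [Tableau.mem_lower] at hk3
        have hk5 := a.rowOf_lt (q⁻¹ (p⁻¹ k))
        rw [hk4] at hk5
        have hk6 := μ.colLen_anti _ _ hk2.2
        rw [hx, Finset.mem_coe, Finset.mem_Ico, Tabloid.row_smul, Tabloid.row_smul,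
          Tabloid.row_tabloid]
        omega)
    exact ⟨k, hk, l, hl, hne, h⟩
  have hanti : symm (permRep μ) Perm.sign (onSet D) v = (stab (onSet D)).card • v := by
    refine symm_of_forall fun σ hσ => ?_
    exact (perm_row_poly a i j hσ).2
  rw [symm_insert hbD, Module.End.mul_apply, hanti, map_nsmul] at hz
  have h1 := (smul_eq_zero.1 hz).resolve_left (card_stab_pos _).ne'
  rw [LinearMap.add_apply, LinearMap.sum_apply, Module.End.one_apply] at h1
  have h2 : ∀ y ∈ D, (((Perm.sign (swap b y) : ℤˣ) : ℤ) • permRep μ (swap b y)) v =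
      -permRep μ (swap b y) v := by
    intro y hy
    rw [Perm.sign_swap fun h : b = y => hbD (by rwa [h])]
    simp
  rw [Finset.sum_congr rfl h2, Finset.sum_neg_distrib, add_neg_eq_zero] at h1
  exact h1.symm

theorem rowFrom_eq_insert (a : Tableau μ) {i j : ℕ} {k : Fin μ.card} (hr : a.rowOf k = i)
    (hc : a.colOf k = j) : a.rowFrom i j = insert k (a.rowFrom i (j + 1)) := by
  ext l
  rw [Finset.mem_insert, Tableau.mem_rowFrom, Tableau.mem_rowFrom]
  constructor
  · rintro ⟨h1, h2⟩
    by_cases h : a.colOf l = j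
    · exact Or.inl (a.eq_of_cell_eq (h1.trans hr.symm) (h.trans hc.symm))
    · exact Or.inr ⟨h1, by omega⟩
  · rintro (rfl | ⟨h1, h2⟩)
    · exact ⟨hr, hc.ge⟩
    · exact ⟨h1, by omega⟩

/-- Let k be the entry of the cell and L = colLen j - i. Adding k to the row symmetrizer adds one
term `swap k b` for each b to its right, and each such term contributes 1/L of the old value. The
new value is thus (1 + arm/L) times the old one, and L + arm is the hook length. -/
theorem form_row_step (a : Tableau μ) {i j : ℕ} (h : (i, j) ∈ μ) :
    form μ (symm (permRep μ) 1 (onSet (a.rowFrom i j)) (a.poly i)) (a.poly i) *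
        ((μ.colLen j - i : ℕ) : ℤ) =
      hookLength μ (i, j) *
        form μ (symm (permRep μ) 1 (onSet (a.rowFrom i (j + 1))) (a.poly i)) (a.poly i) := by
  obtain ⟨k, hr, hc⟩ := a.exists_entry h
  have hk : k ∉ a.rowFrom i (j + 1) := by
    rw [Tableau.mem_rowFrom]
    omega
  have hkD : k ∈ a.colFrom i j := by
    rw [Tableau.mem_colFrom]
    omega
  have hlen := YoungDiagram.mem_iff_lt_colLen.1 h
  have hlen' := YoungDiagram.mem_iff_lt_rowLen.1 h
  set v := symm (permRep μ) 1 (onSet (a.rowFrom i (j + 1))) (a.poly i) with hv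
  -- The L terms of the Garnir relation for `b` all have the same product with the polytabloid:
  -- `swap b y` is conjugate to `swap k b` by `swap k y`, which acts on both arguments of the form
  -- by the same sign.
  have key : ∀ b ∈ a.rowFrom i (j + 1),
      ((μ.colLen j - i : ℕ) : ℤ) * form μ (permRep μ (swap k b) v) (a.poly i) =
        form μ v (a.poly i) := by
    intro b hb
    conv_rhs => rw [hv, ← sum_swap_row_poly a i j hb, map_sum, LinearMap.sum_apply]
    rw [Finset.sum_congr rfl (g := fun _ => form μ (permRep μ (swap k b) v) (a.poly i)),
      Finset.sum_const, Tableau.card_colFrom, nsmul_eq_mul]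
    intro y hy
    have hbD : b ∉ a.colFrom i j := by
      rw [Tableau.mem_colFrom]
      rw [Tableau.mem_rowFrom] at hb
      omega
    have hs : swap k y ∈ stab (onSet (a.colFrom i j)) := by
      refine swap_mem_stab ?_
      rw [onSet, onSet, if_pos hkD, if_pos hy]
    have hconj : swap b y = swap k y * swap k b * swap k y := by
      have h1 := swap_apply_apply (swap k y) k b
      rw [swap_apply_left, swap_apply_of_ne_of_ne (fun h : b = k => hbD (by rwa [h]))
        (fun h : b = y => hbD (by rwa [h])), swap_inv] at h1
      rw [swap_comm b y, h1]
    obtain ⟨h1, h2⟩ := perm_row_poly a i j hs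
    rw [hconj, map_mul, map_mul, Module.End.mul_apply, Module.End.mul_apply, form_permRep, swap_inv,
      h1, ← hv, h2, ← hv, map_smul, map_smul, map_smul, LinearMap.smul_apply, smul_smul,
      units_mul_self, one_smul]
  have hsum : ((μ.colLen j - i : ℕ) : ℤ) *
      ∑ b ∈ a.rowFrom i (j + 1), form μ (permRep μ (swap k b) v) (a.poly i) =
      ((μ.rowLen i - (j + 1) : ℕ) : ℤ) * form μ v (a.poly i) := by
    rw [Finset.mul_sum, Finset.sum_congr rfl key, Finset.sum_const, Tableau.card_rowFrom,
      nsmul_eq_mul]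
  rw [rowFrom_eq_insert a hr hc, symm_insert hk, Module.End.mul_apply, ← hv, LinearMap.add_apply,
    LinearMap.sum_apply, Module.End.one_apply, map_add, LinearMap.add_apply, map_sum,
    LinearMap.sum_apply]
  simp only [MonoidHom.one_apply, Units.val_one, one_smul]
  rw [add_mul, mul_comm (Finset.sum _ _), hsum, hookLength]
  have : μ.colLen j - (i + 1) + 1 = μ.colLen j - i := by omega
  simp only
  rw [add_assoc, this]
  push_cast
  ring

/-- One of the two polytabloids is a column symmetrizer applied to {a}; moved to the other one, it
multiplies it by the order of the group. -/
theorem form_poly_self (a : Tableau μ) (i : ℕ) :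
    form μ (a.poly i) (a.poly i) = (stab (inside (a.lower i) a.colOf)).card := by
  have h : form μ (a.poly i) (a.poly i) =
      form μ (Finsupp.single a.tabloid 1) (a.colSym i (a.poly i)) := by
    conv_lhs => enter [1, 2]; rw [Tableau.poly]
    rw [Tableau.colSym, form_symm]
  rw [h, Tableau.colSym, symm_of_forall fun σ hσ => perm_poly hσ, map_nsmul,
    form_single_left, poly_apply_self, nsmul_eq_mul, mul_one]

/-- The orbit of the entry in cell (i, j) is column j from row i on, and its stabilizer is the group
on the right. -/
theorem card_stab_col_step (a : Tableau μ) {i j : ℕ} (h : (i, j) ∈ μ) :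
    (stab (inside (a.lower (i + 1) ∪ a.rowFrom i j) a.colOf)).card =
      (μ.colLen j - i) * (stab (inside (a.lower (i + 1) ∪ a.rowFrom i (j + 1)) a.colOf)).card := by
  obtain ⟨k, hr, hc⟩ := a.exists_entry h
  have hin : ∀ l, a.colOf l = j → (l ∈ a.lower (i + 1) ∪ a.rowFrom i j ↔ i ≤ a.rowOf l) := by
    intro l hl
    rw [Finset.mem_union, Tableau.mem_lower, Tableau.mem_rowFrom]
    omega
  have hk : k ∈ a.lower (i + 1) ∪ a.rowFrom i j := (hin k hc).2 hr.ge
  rw [card_stab_eq _ k (Y := a.colFrom i j), Tableau.card_colFrom]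
  · congr 2
    ext σ
    rw [mem_stab_fixAt, mem_stab_inside, mem_stab_inside, and_assoc]
    refine and_congr_right fun _ => ⟨?_, fun h => ⟨fun l hl => h l ?_, h k ?_⟩⟩
    · rintro ⟨h1, h2⟩ l hl
      by_cases hlk : l = k
      · rw [hlk, h2]
      · refine h1 l ?_
        rw [rowFrom_eq_insert a hr hc]
        simp only [Finset.mem_union, Finset.mem_insert] at hl ⊢
        tauto
    · rw [rowFrom_eq_insert a hr hc] at hl
      simp only [Finset.mem_union, Finset.mem_insert] at hl ⊢
      tauto
    · rw [Finset.mem_union, Tableau.mem_lower, Tableau.mem_rowFrom]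
      omega
  · intro y
    rw [inside, inside, if_pos hk, Tableau.mem_colFrom]
    split_ifs with hy
    · rw [Sum.inl.injEq, hc]
      exact ⟨fun h => h.1, fun h => ⟨h, (hin y h).1 hy⟩⟩
    · simp only [iff_false, not_and]
      exact fun h h' => hy ((hin y h).2 h')

/-- Symmetrizing row `i` contributes the product of the hook lengths of its cells. -/
theorem form_row_poly (a : Tableau μ) (i : ℕ) :
    form μ (symm (permRep μ) 1 (onSet (a.rowFrom i 0)) (a.poly i)) (a.poly i) =
      (∏ j ∈ Finset.range (μ.rowLen i), (hookLength μ (i, j) : ℤ)) *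
        (stab (inside (a.lower (i + 1)) a.colOf)).card := by
  -- Here m counts the symmetrized cells, from the right. The group order on the left absorbs the
  -- factors colLen j - i of `form_row_step`, so no division is needed; with the row complete it
  -- cancels.
  have key : ∀ m ≤ μ.rowLen i,
      form μ (symm (permRep μ) 1 (onSet (a.rowFrom i (μ.rowLen i - m))) (a.poly i)) (a.poly i) *
        (stab (inside (a.lower (i + 1) ∪ a.rowFrom i (μ.rowLen i - m)) a.colOf)).card =
      (∏ j ∈ Finset.Ico (μ.rowLen i - m) (μ.rowLen i), (hookLength μ (i, j) : ℤ)) *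
        (stab (inside (a.lower (i + 1)) a.colOf)).card *
        (stab (inside (a.lower i) a.colOf)).card := by
    intro m
    induction m with
    | zero =>
      intro _
      have he : a.rowFrom i (μ.rowLen i - 0) = ∅ := by
        rw [← Finset.card_eq_zero, Tableau.card_rowFrom]
        omega
      have hone : stab (onSet (∅ : Finset (Fin μ.card))) = {1} := by
        ext σ
        rw [mem_stab_onSet, Finset.mem_singleton, Perm.ext_iff]
        simp
      rw [he, Finset.union_empty, YoungSymm.symm, hone, Finset.sum_singleton, map_one, map_one, Units.val_one,
        one_smul, Module.End.one_apply, form_poly_self]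
      simp [mul_comm]
    | succ m ih =>
      intro hm
      have ih := ih (by omega)
      set j := μ.rowLen i - (m + 1) with hj
      have hj1 : μ.rowLen i - m = j + 1 := by omega
      have hmem : (i, j) ∈ μ := YoungDiagram.mem_iff_lt_rowLen.2 (by omega)
      rw [hj1] at ih
      rw [card_stab_col_step a hmem, Nat.cast_mul, ← mul_assoc, form_row_step a hmem,
        mul_assoc, ih, Finset.prod_eq_prod_Ico_succ_bot (show j < μ.rowLen i by omega)]
      ring
  have h := key (μ.rowLen i) le_rfl
  have hu : a.lower (i + 1) ∪ a.rowFrom i 0 = a.lower i := by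
    ext k
    rw [Finset.mem_union, Tableau.mem_lower, Tableau.mem_lower, Tableau.mem_rowFrom]
    omega
  rw [Nat.sub_self, hu, Nat.Ico_zero_eq_range] at h
  have hpos := card_stab_pos (inside (a.lower i) a.colOf)
  exact mul_right_cancel₀ (by exact_mod_cast hpos.ne') h

theorem form_rowSym_poly_step (a : Tableau μ) (i : ℕ) :
    form μ (a.rowSym i (a.poly i)) (a.poly i) =
      (∏ j ∈ Finset.range (μ.rowLen i), (hookLength μ (i, j) : ℤ)) *
        form μ (a.rowSym (i + 1) (a.poly (i + 1))) (a.poly (i + 1)) := by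
  have h := form_rowSym_mul_card a i
  rw [form_row_poly] at h
  have hpos := card_stab_pos (inside (a.lower (i + 1)) a.colOf)
  refine mul_right_cancel₀ (b := ((stab (inside (a.lower (i + 1)) a.colOf)).card : ℤ))
    (by exact_mod_cast hpos.ne') ?_
  rw [h]
  ring

/-! ### The scalar as a product of hook lengths -/

/-- The product of all hook lengths of `μ`. -/
def hookProduct (μ : YoungDiagram) : ℕ := ∏ c ∈ μ.cells, hookLength μ c

theorem form_rowSym_poly (a : Tableau μ) :
    form μ (a.rowSym 0 (a.poly 0)) (a.poly 0) = hookProduct μ := by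
  have key : ∀ m, form μ (a.rowSym 0 (a.poly 0)) (a.poly 0) =
      (∏ i ∈ Finset.range m, ∏ j ∈ Finset.range (μ.rowLen i), (hookLength μ (i, j) : ℤ)) *
        form μ (a.rowSym m (a.poly m)) (a.poly m) := by
    intro m
    induction m with
    | zero => simp
    | succ m ih => rw [ih, form_rowSym_poly_step a m, Finset.prod_range_succ, mul_assoc]
  have hlow : a.lower (μ.colLen 0) = ∅ := by
    ext k
    have h1 := a.rowOf_lt k
    have h2 := μ.colLen_anti 0 (a.colOf k) (Nat.zero_le _)
    rw [Tableau.mem_lower]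
    simp only [Finset.notMem_empty, iff_false]
    omega
  have hone : ∀ g : Fin μ.card → ℕ, stab (inside (∅ : Finset (Fin μ.card)) g) = {1} := by
    intro g
    ext σ
    rw [mem_stab_inside, Finset.mem_singleton, Perm.ext_iff]
    simp only [Finset.notMem_empty, not_false_eq_true, forall_const, Perm.one_apply,
      and_iff_right_iff_imp]
    intro h
    rw [mem_stab]
    intro k
    rw [h]
  rw [key (μ.colLen 0), Tableau.rowSym, hlow, YoungSymm.symm, hone, Finset.sum_singleton, map_one, map_one,
    Units.val_one, one_smul, Module.End.one_apply, form_poly_self, hlow, hone,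
    Finset.card_singleton, Nat.cast_one, mul_one, hookProduct, Nat.cast_prod,
    Finset.prod_sigma']
  refine Finset.prod_bij' (fun p _ => (p.1, p.2)) (fun c _ => ⟨c.1, c.2⟩) ?_ ?_ ?_ ?_ ?_
  · rintro ⟨i, j⟩ h
    simp only [Finset.mem_sigma, Finset.mem_range] at h
    exact (YoungDiagram.mem_cells _).2 (YoungDiagram.mem_iff_lt_rowLen.2 h.2)
  · rintro ⟨i, j⟩ h
    rw [YoungDiagram.mem_cells] at h
    simp only [Finset.mem_sigma, Finset.mem_range]
    refine ⟨?_, YoungDiagram.mem_iff_lt_rowLen.1 h⟩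
    exact YoungDiagram.mem_iff_lt_colLen.1 (YoungDiagram.up_left_mem μ le_rfl (Nat.zero_le _) h)
  · simp
  · simp
  · simp

theorem colSym_rowSym_poly_zero (a : Tableau μ) :
    a.colSym 0 (a.rowSym 0 (a.poly 0)) = (hookProduct μ : ℤ) • a.poly 0 := by
  rw [colSym_rowSym_poly, form_rowSym_poly]

end Specht

/-! ### The sign-twisted endomorphism of the Specht module of a symmetric partition -/

namespace Specht

open Equiv YoungSymm

variable {μ : YoungDiagram}

theorem poly_act (a : Tableau μ) (σ : Perm (Fin μ.card)) :
    Tableau.poly (a.act σ) 0 = permRep μ σ (a.poly 0) := by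
  rw [Tableau.poly, Tableau.poly, Tableau.colSym, Tableau.colSym, perm_symm_conj, permRep_single,
    smul_tabloid]
  refine congrFun (congrArg DFunLike.coe (symm_congr ?_)) _
  ext τ
  rw [mem_stab_col, mem_stab]
  simp [inside, Tableau.mem_lower, Tableau.colOf_act]

theorem exists_act_eq (a b : Tableau μ) : ∃ σ, b = a.act σ :=
  ⟨a.symm.trans b, by ext c; simp [Tableau.act]⟩

theorem poly_mem_spechtModule (a : Tableau μ) : a.poly 0 ∈ spechtModule μ := by
  rw [← polytabloid_eq]
  exact Submodule.subset_span ⟨a, rfl⟩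

theorem spechtModule_eq_span :
    spechtModule μ = Submodule.span ℤ (Set.range fun a : Tableau μ => a.poly 0) := by
  simp only [spechtModule, polytabloid_eq]

theorem permRep_mem_spechtModule (σ : Perm (Fin μ.card)) {v : PermModule μ}
    (hv : v ∈ spechtModule μ) : permRep μ σ v ∈ spechtModule μ := by
  rw [spechtModule_eq_span] at hv
  induction hv using Submodule.span_induction with
  | mem x hx =>
    obtain ⟨a, rfl⟩ := hx
    rw [← poly_act]
    exact poly_mem_spechtModule _
  | zero => simp
  | add x y _ _ hx hy => rw [map_add]; exact add_mem hx hy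
  | smul c x _ hx => rw [map_smul]; exact Submodule.smul_mem _ _ hx

/-! ### Signs and transposes of tableaux -/

/-- A tableau, taken as a reference for signs. -/
noncomputable def baseTableau (μ : YoungDiagram) : Tableau μ := μ.cells.equivFin

/-- The sign of a tableau. -/
noncomputable def Tableau.sgn (a : Tableau μ) : ℤˣ := Perm.sign ((baseTableau μ).symm.trans a)

theorem sgn_act (a : Tableau μ) (σ : Perm (Fin μ.card)) :
    Tableau.sgn (a.act σ) = Perm.sign σ * a.sgn := by
  rw [Tableau.sgn, Tableau.sgn, ← map_mul]
  rfl

theorem sgn_baseTableau : (baseTableau μ).sgn = 1 := by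
  rw [Tableau.sgn, Equiv.symm_trans_self]
  exact map_one Perm.sign

theorem swap_mem_cells (h : μ.transpose = μ) {c : ℕ × ℕ} (hc : c ∈ μ.cells) :
    c.swap ∈ μ.cells := by
  rw [YoungDiagram.mem_cells] at *
  have : c.swap ∈ μ.transpose := YoungDiagram.mem_transpose.2 (by rwa [Prod.swap_swap])
  rwa [h] at this

/-- Reflection of the cells of a symmetric diagram. -/
def cellSwap (h : μ.transpose = μ) : Perm μ.cells where
  toFun c := ⟨c.1.swap, swap_mem_cells h c.2⟩
  invFun c := ⟨c.1.swap, swap_mem_cells h c.2⟩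
  left_inv c := by simp
  right_inv c := by simp

/-- The transposed tableau. -/
def Tableau.transp (h : μ.transpose = μ) (a : Tableau μ) : Tableau μ := (cellSwap h).trans a

variable (h : μ.transpose = μ)

@[simp]
theorem rowOf_transp (a : Tableau μ) (k : Fin μ.card) :
    Tableau.rowOf (a.transp h) k = a.colOf k := rfl

@[simp]
theorem colOf_transp (a : Tableau μ) (k : Fin μ.card) :
    Tableau.colOf (a.transp h) k = a.rowOf k := rfl

@[simp]
theorem transp_transp (a : Tableau μ) : Tableau.transp h (a.transp h) = a :=
  Tableau.ext_cell (fun _ => rfl) fun _ => rfl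

theorem transp_act (a : Tableau μ) (σ : Perm (Fin μ.card)) :
    Tableau.transp h (a.act σ) = Tableau.act (a.transp h) σ := rfl

/-- The sign relating tableaux and their transposes. -/
noncomputable def transpSign : ℤˣ := ((baseTableau μ).transp h).sgn

theorem sgn_transp (a : Tableau μ) : (a.transp h).sgn = transpSign h * a.sgn := by
  obtain ⟨σ, rfl⟩ := exists_act_eq (baseTableau μ) a
  rw [transp_act, sgn_act, sgn_act, sgn_baseTableau, mul_one, transpSign, mul_comm]

theorem stab_col_transp (a : Tableau μ) :
    stab (inside ((a.transp h).lower 0) (a.transp h).colOf) = stab (inside (a.lower 0) a.rowOf) := by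
  ext σ
  rw [mem_stab_col, mem_stab_row]
  simp

theorem stab_row_transp (a : Tableau μ) :
    stab (inside ((a.transp h).lower 0) (a.transp h).rowOf) = stab (inside (a.lower 0) a.colOf) := by
  ext σ
  rw [mem_stab_col, mem_stab_row]
  simp

theorem act_eq_of_tabloid_eq {a b : Tableau μ} (hab : a.tabloid = b.tabloid) :
    ∃ σ ∈ stab (inside (a.lower 0) a.rowOf), b = a.act σ := by
  obtain ⟨σ, rfl⟩ := exists_act_eq a b
  refine ⟨σ, mem_stab_row.2 ⟨fun k => ?_, by simp⟩, rfl⟩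
  have := congrFun (congrArg Tabloid.row hab) (σ k)
  rw [Tabloid.row_tabloid, Tabloid.row_tabloid, Tableau.rowOf_act] at this
  simpa using this

/-! ### The twist and its square -/

/-- The map `{a} ↦ ± ⟨a'⟩`, which is equivariant up to the sign character. -/
noncomputable def twist : Module.End ℤ (PermModule μ) :=
  Finsupp.linearCombination ℤ fun x : Tabloid μ =>
    ((x.exists_tableau.choose.sgn : ℤˣ) : ℤ) • (x.exists_tableau.choose.transp h).poly 0

/-- The chosen representative is irrelevant: it differs from `a` by a row permutation, which is a
column permutation of the transpose, so its sign appears twice. -/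
theorem twist_single (a : Tableau μ) :
    twist h (Finsupp.single a.tabloid 1) = ((a.sgn : ℤˣ) : ℤ) • (a.transp h).poly 0 := by
  rw [twist, Finsupp.linearCombination_single, one_smul]
  have hb := a.tabloid.exists_tableau.choose_spec
  set b := a.tabloid.exists_tableau.choose with hbdef
  obtain ⟨σ, hσ, hbσ⟩ := act_eq_of_tabloid_eq hb.symm
  rw [hbσ, sgn_act, transp_act, poly_act, perm_poly (by rwa [stab_col_transp]), smul_smul,
    Units.val_mul, mul_right_comm, units_mul_self, one_mul]

theorem twist_permRep (σ : Perm (Fin μ.card)) (v : PermModule μ) :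
    twist h (permRep μ σ v) = ((Perm.sign σ : ℤˣ) : ℤ) • permRep μ σ (twist h v) := by
  rw [eq_sum_single v]
  simp only [map_sum, map_smul, Finset.smul_sum]
  refine Finset.sum_congr rfl fun x _ => ?_
  obtain ⟨a, rfl⟩ := x.exists_tableau
  rw [permRep_single, smul_tabloid, twist_single, twist_single, sgn_act, transp_act, poly_act,
    map_smul, Units.val_mul, smul_comm _ (v _)]
  simp only [smul_smul]

/-- Equivariance up to sign multiplies the character by the sign; this exchanges the two kinds of
symmetrizers. -/
theorem twist_symm {α : Type*} (χ : Perm (Fin μ.card) →* ℤˣ) (g : Fin μ.card → α)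
    (v : PermModule μ) :
    twist h (YoungSymm.symm (permRep μ) χ g v) =
      YoungSymm.symm (permRep μ) (χ * Perm.sign) g (twist h v) := by
  rw [symm_apply, symm_apply, map_sum]
  refine Finset.sum_congr rfl fun σ _ => ?_
  rw [map_smul, twist_permRep, smul_smul, MonoidHom.mul_apply, Units.val_mul]

theorem sign_mul_sign : (Perm.sign : Perm (Fin μ.card) →* ℤˣ) * Perm.sign = 1 := by
  ext σ
  simp

theorem twist_poly (a : Tableau μ) :
    twist h (a.poly 0) =
      ((a.sgn : ℤˣ) : ℤ) • (a.transp h).rowSym 0 ((a.transp h).poly 0) := by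
  rw [Tableau.poly, Tableau.colSym, twist_symm, twist_single, map_smul, sign_mul_sign,
    Tableau.rowSym, symm_congr (stab_row_transp h a)]

/-- Rows of the transpose are columns of `a`, so applying the twist twice amounts to a row
symmetrizer followed by a column symmetrizer of `a`, with scalar the hook product. -/
theorem twist_twist_poly (a : Tableau μ) :
    twist h (twist h (a.poly 0)) = (transpSign h * hookProduct μ : ℤ) • a.poly 0 := by
  rw [twist_poly, map_smul, Tableau.rowSym, twist_symm, one_mul, twist_poly, transp_transp,
    map_smul, symm_congr (stab_row_transp h a), ← Tableau.colSym, colSym_rowSym_poly_zero,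
    smul_smul, smul_smul, sgn_transp, Units.val_mul, mul_left_comm, units_mul_self, mul_one]

theorem twist_mem (v : PermModule μ) : twist h v ∈ spechtModule μ := by
  rw [eq_sum_single v, map_sum]
  refine Submodule.sum_mem _ fun x _ => ?_
  obtain ⟨a, rfl⟩ := x.exists_tableau
  rw [map_smul, twist_single]
  exact Submodule.smul_mem _ _ (Submodule.smul_mem _ _ (poly_mem_spechtModule _))

theorem twist_twist {v : PermModule μ} (hv : v ∈ spechtModule μ) :
    twist h (twist h v) = (transpSign h * hookProduct μ : ℤ) • v := by
  rw [spechtModule_eq_span] at hv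
  induction hv using Submodule.span_induction with
  | mem x hx =>
    obtain ⟨a, rfl⟩ := hx
    exact twist_twist_poly h a
  | zero => simp
  | add x y _ _ hx hy => rw [map_add, map_add, hx, hy, smul_add]
  | smul c x _ hx => rw [map_smul, map_smul, hx, smul_comm]

theorem twist_single_transp (a : Tableau μ) :
    twist h (Finsupp.single a.tabloid 1) (a.transp h).tabloid = ((a.sgn : ℤˣ) : ℤ) := by
  rw [twist_single, Finsupp.smul_apply, poly_apply_self, smul_eq_mul, mul_one]

theorem exists_of_twist_ne_zero {x y : Tabloid μ} (hxy : twist h (Finsupp.single x 1) y ≠ 0) :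
    ∃ c : Tableau μ, c.tabloid = x ∧ (c.transp h).tabloid = y := by
  obtain ⟨a, rfl⟩ := x.exists_tableau
  rw [twist_single, Finsupp.smul_apply] at hxy
  obtain ⟨q, hq, rfl⟩ := exists_of_poly_apply_ne_zero (right_ne_zero_of_smul hxy)
  refine ⟨a.act q, ?_, by rw [transp_act, smul_tabloid]⟩
  rw [stab_col_transp, mem_stab_row] at hq
  refine Tabloid.ext_row fun k => ?_
  rw [Tabloid.row_tabloid, Tabloid.row_tabloid, Tableau.rowOf_act, ← hq.1 (q⁻¹ k)]
  simp

/-- A coefficient is nonzero only if one tableau has `x` as its rows and `y` as its columns. This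
condition is symmetric, and the two coefficients are the signs of that tableau and its transpose. -/
theorem twist_single_apply_comm (x y : Tabloid μ) :
    twist h (Finsupp.single x 1) y =
      ((transpSign h : ℤˣ) : ℤ) * twist h (Finsupp.single y 1) x := by
  have key : ∀ c : Tableau μ, twist h (Finsupp.single c.tabloid 1) (c.transp h).tabloid =
      ((transpSign h : ℤˣ) : ℤ) * twist h (Finsupp.single (c.transp h).tabloid 1) c.tabloid := by
    intro c
    have h1 := twist_single_transp h (c.transp h)
    rw [transp_transp] at h1
    rw [twist_single_transp, h1, sgn_transp, Units.val_mul, ← mul_assoc, units_mul_self, one_mul]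
  by_cases hxy : twist h (Finsupp.single x 1) y = 0
  · by_cases hyx : twist h (Finsupp.single y 1) x = 0
    · rw [hxy, hyx, mul_zero]
    · obtain ⟨c, rfl, rfl⟩ := exists_of_twist_ne_zero h hyx
      rw [key c, ← mul_assoc, units_mul_self, one_mul]
  · obtain ⟨c, rfl, rfl⟩ := exists_of_twist_ne_zero h hxy
    exact key c

theorem form_twist (u v : PermModule μ) :
    form μ (twist h u) v = transpSign h * form μ u (twist h v) := by
  rw [eq_sum_single u, eq_sum_single v]
  simp only [map_sum, map_smul, LinearMap.sum_apply, LinearMap.smul_apply, form_single_left,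
    form_single_right, Finset.mul_sum, smul_eq_mul]
  refine Finset.sum_congr rfl fun x _ => Finset.sum_congr rfl fun y _ => ?_
  rw [twist_single_apply_comm h]
  ring

end Specht

/-! ### The standard basis of the Specht module -/

namespace Specht

open Equiv YoungSymm

variable {μ : YoungDiagram}

/-- A tableau whose rows and columns are increasing. -/
def Tableau.IsStandard (a : Tableau μ) : Prop :=
  (∀ k l, a.colOf k = a.colOf l → a.rowOf k < a.rowOf l → k < l) ∧
    ∀ k l, a.rowOf k = a.rowOf l → a.colOf k < a.colOf l → k < l

/-- The standard tableaux. -/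
abbrev Std (μ : YoungDiagram) : Type := {a : Tableau μ // a.IsStandard}

/-- Rows increase, so the column is determined by the row sets; hence a standard tableau is
determined by its tabloid. -/
theorem colOf_eq_card {a : Tableau μ} (ha : a.IsStandard) (k : Fin μ.card) :
    a.colOf k = (Finset.univ.filter fun l => a.rowOf l = a.rowOf k ∧ l < k).card := by
  symm
  rw [← Finset.card_range (a.colOf k)]
  refine Finset.card_nbij a.colOf ?_ ?_ ?_
  · intro l hl
    simp only [Finset.coe_filter, Finset.mem_univ, true_and, Set.mem_ofPred_eq] at hl
    rw [Finset.mem_coe, Finset.mem_range]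
    by_contra h
    rcases (not_lt.1 h).lt_or_eq with h1 | h1
    · exact absurd (ha.2 k l hl.1.symm h1) hl.2.le.not_gt
    · exact hl.2.ne (a.eq_of_cell_eq hl.1 h1.symm)
  · intro l hl l' hl' h
    simp only [Finset.coe_filter, Finset.mem_univ, true_and, Set.mem_ofPred_eq] at hl hl'
    exact a.eq_of_cell_eq (hl.1.trans hl'.1.symm) h
  · intro c hc
    rw [Finset.mem_coe, Finset.mem_range] at hc
    obtain ⟨l, hl, hl'⟩ := a.exists_entry (YoungDiagram.up_left_mem μ le_rfl hc.le (a.mem k))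
    refine ⟨l, ?_, hl'⟩
    simp only [Finset.coe_filter, Finset.mem_univ, true_and, Set.mem_ofPred_eq]
    exact ⟨hl, ha.2 l k hl (by rwa [hl'])⟩

theorem eq_of_tabloid_eq {a b : Tableau μ} (ha : a.IsStandard) (hb : b.IsStandard)
    (h : ∀ k, a.rowOf k = b.rowOf k) : a = b := by
  refine Tableau.ext_cell h fun k => ?_
  rw [colOf_eq_card ha, colOf_eq_card hb]
  simp only [h]

/-- The rows of the entries, the largest entry first. -/
def rowWord (a : Std μ) : Lex (Fin μ.card → ℕ) := toLex fun k => a.1.rowOf k.rev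

theorem rowWord_injective : Function.Injective (rowWord (μ := μ)) := by
  intro a b h
  refine Subtype.ext (eq_of_tabloid_eq a.2 b.2 fun k => ?_)
  have := congrFun (toLex.injective h) k.rev
  simpa using this

noncomputable instance : LinearOrder (Std μ) := LinearOrder.lift' rowWord rowWord_injective

noncomputable instance : Fintype (Std μ) := Fintype.ofFinite _

/-- The coefficients of the standard polytabloids at the standard tabloids. -/
noncomputable def stdMatrix (μ : YoungDiagram) : Matrix (Std μ) (Std μ) ℤ :=
  Matrix.of fun t s => s.1.poly 0 t.1.tabloid

/-- If t arises from s by a column permutation, consider the largest entry k whose position changes.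
A smaller entry of the same column takes k's place in the permutation, so k is higher in t than in
s, while larger entries agree; hence t < s. -/
theorem stdMatrix_eq_zero {s t : Std μ} (hst : s < t) : stdMatrix μ t s = 0 := by
  by_contra h
  obtain ⟨q, hq, hx⟩ := exists_of_poly_apply_ne_zero h
  rw [mem_stab_col] at hq
  have hrow : ∀ k, t.1.rowOf k = s.1.rowOf (q⁻¹ k) := fun k => congrFun (congrArg Tabloid.row hx) k
  have hcol : ∀ k, s.1.colOf (q⁻¹ k) = s.1.colOf k := fun k => by
    rw [← hq.1 (q⁻¹ k)]
    simp
  by_cases hfix : ∀ k, q⁻¹ k = k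
  · refine hst.ne (Subtype.ext (eq_of_tabloid_eq s.2 t.2 fun k => ?_))
    rw [hrow, hfix]
  · push Not at hfix
    obtain ⟨k, hk, hmax⟩ := Finset.exists_maximal (s := Finset.univ.filter fun k => q⁻¹ k ≠ k)
      (by obtain ⟨k, hk⟩ := hfix; exact ⟨k, by simpa using hk⟩)
    rw [Finset.mem_filter] at hk
    have hgt : ∀ m, k < m → q⁻¹ m = m := by
      intro m hm
      by_contra hne
      exact hm.not_ge (hmax (by simpa using hne) hm.le)
    have hlt : q⁻¹ k < k := by
      rcases lt_trichotomy (q⁻¹ k) k with h1 | h1 | h1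
      · exact h1
      · exact absurd h1 hk.2
      · exact absurd (q⁻¹.injective (hgt _ h1)) hk.2
    have hr : s.1.rowOf (q⁻¹ k) < s.1.rowOf k := by
      rcases lt_trichotomy (s.1.rowOf (q⁻¹ k)) (s.1.rowOf k) with h1 | h1 | h1
      · exact h1
      · exact absurd (s.1.eq_of_cell_eq h1 (hcol k)) hk.2
      · exact absurd (s.2.1 _ _ (hcol k).symm h1) hlt.le.not_gt
    refine hst.asymm (show rowWord t < rowWord s from ⟨k.rev, fun m hm => ?_, ?_⟩)
    · change t.1.rowOf m.rev = s.1.rowOf m.rev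
      rw [hrow, hgt m.rev (by rwa [← Fin.rev_lt_rev, Fin.rev_rev])]
    · change t.1.rowOf k.rev.rev < s.1.rowOf k.rev.rev
      rwa [Fin.rev_rev, hrow]

theorem det_stdMatrix : (stdMatrix μ).det = 1 := by
  have h : (stdMatrix μ).IsUpperTriangular := fun t s h => stdMatrix_eq_zero h
  rw [Matrix.det_of_isUpperTriangular h]
  exact Finset.prod_eq_one fun s _ => poly_apply_self s.1 0

/-! #### Straightening -/

/-- The vectors that have a positive multiple in `W`. -/
def saturation {V : Type*} [AddCommGroup V] (W : Submodule ℤ V) : Submodule ℤ V where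
  carrier := {v | ∃ N : ℕ, 0 < N ∧ N • v ∈ W}
  zero_mem' := ⟨1, one_pos, by simp⟩
  add_mem' := by
    rintro u v ⟨M, hM, hu⟩ ⟨N, hN, hv⟩
    refine ⟨M * N, Nat.mul_pos hM hN, ?_⟩
    rw [smul_add]
    refine add_mem ?_ ?_
    · rw [mul_comm, mul_smul]
      exact W.smul_of_tower_mem N hu
    · rw [mul_smul]
      exact W.smul_of_tower_mem M hv
  smul_mem' := by
    rintro c v ⟨N, hN, hv⟩
    refine ⟨N, hN, ?_⟩
    rw [smul_comm]
    exact W.smul_mem c hv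

theorem mem_saturation_of_nsmul {V : Type*} [AddCommGroup V] {W : Submodule ℤ V} {N : ℕ}
    (hN : 0 < N) {v : V} (h : N • v ∈ saturation W) : v ∈ saturation W := by
  obtain ⟨M, hM, h⟩ := h
  exact ⟨M * N, Nat.mul_pos hM hN, by rwa [mul_smul]⟩

theorem le_saturation {V : Type*} [AddCommGroup V] (W : Submodule ℤ V) : W ≤ saturation W :=
  fun v hv => ⟨1, one_pos, by simpa using hv⟩

/-- The rearrangement inequality on `K`: the weights m and values f m are oppositely ordered, so a
permutation undoing this strictly increases the sum. -/
theorem sum_lt_sum_perm {n : ℕ} {f : Fin n → ℕ} {K : Finset (Fin n)} {σ : Perm (Fin n)}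
    (hf : ∀ x ∈ K, ∀ y ∈ K, x < y → f y ≤ f x) (hσ : σ ∈ stab (onSet K))
    (hxy : ∃ x ∈ K, ∃ y ∈ K, x < y ∧ f (σ⁻¹ x) < f (σ⁻¹ y)) :
    ∑ m : Fin _, (m : ℕ) * f m < ∑ m : Fin _, (m : ℕ) * f (σ⁻¹ m) := by
  have hanti : AntivaryOn (fun m : Fin n => (m : ℕ)) f K := by
    intro x hx y hy h
    by_contra hlt
    exact absurd (hf x hx y hy (by simpa using hlt)) h.not_ge
  have hsub : {x | σ⁻¹ x ≠ x} ⊆ (K : Set (Fin n)) := by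
    intro x hx
    by_contra h
    exact hx (mem_stab_onSet.1 (inv_mem_stab hσ) x h)
  have key := (hanti.sum_mul_lt_sum_mul_comp_perm_iff hsub).2 (by
    intro h
    obtain ⟨x, hx, y, hy, hlt, h1⟩ := hxy
    exact absurd (h hx hy h1) (not_le.2 hlt))
  have hout : ∑ m ∈ Kᶜ, (m : ℕ) * f m = ∑ m ∈ Kᶜ, (m : ℕ) * f (σ⁻¹ m) := by
    refine Finset.sum_congr rfl fun m hm => ?_
    rw [mem_stab_onSet.1 (inv_mem_stab hσ) m (Finset.mem_compl.1 hm)]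
  rw [← Finset.sum_add_sum_compl K, ← Finset.sum_add_sum_compl K (fun m => (m : ℕ) * f (σ⁻¹ m)),
    hout]
  exact Nat.add_lt_add_right key _

/-- The weights of a tableau, increased by straightening. -/
def Tableau.weight (a : Tableau μ) : ℕ ×ₗ ℕ :=
  toLex (∑ m : Fin _, (m : ℕ) * a.colOf m, ∑ m : Fin _, (m : ℕ) * a.rowOf m)

/-- A nonstandard polytabloid is, up to a factor, a combination of polytabloids of larger weight. -/
theorem straighten (a : Tableau μ) (ha : ¬ a.IsStandard) (W : Submodule ℤ (PermModule μ))
    (hW : ∀ b : Tableau μ, a.weight < b.weight → b.poly 0 ∈ saturation W) :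
    a.poly 0 ∈ saturation W := by
  classical
  by_cases hcol : ∀ k l, a.colOf k = a.colOf l → a.rowOf k < a.rowOf l → k < l
  · obtain ⟨k, l, hr, hc, hlk⟩ : ∃ k l, a.rowOf k = a.rowOf l ∧ a.colOf k < a.colOf l ∧ l < k := by
      by_contra! hcon
      exact ha ⟨hcol, fun k l h1 h2 => lt_of_le_of_ne (hcon k l h1 h2) fun h => by
        rw [h] at h2; exact lt_irrefl _ h2⟩
    set i := a.rowOf k with hi
    -- The classical Garnir sets for a descent in row i: the left column from row i down and the
    -- right column down to row i. Together they exceed the length of the left column by one, and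
    -- every entry of `X` is larger than every entry of `Y`.
    set X := a.colFrom i (a.colOf k) with hX
    set Y : Finset (Fin μ.card) := {m | a.colOf m = a.colOf l ∧ a.rowOf m ≤ i} with hY
    have memX : ∀ m, m ∈ X ↔ a.colOf m = a.colOf k ∧ i ≤ a.rowOf m := fun m =>
      Tableau.mem_colFrom
    have memY : ∀ m, m ∈ Y ↔ a.colOf m = a.colOf l ∧ a.rowOf m ≤ i := fun m => by simp [hY]
    have hXY : Disjoint X Y := by
      rw [Finset.disjoint_left]
      intro m hm hm'
      rw [memX] at hm
      rw [memY] at hm'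
      omega
    have hkX : ∀ m ∈ X, k ≤ m := by
      intro m hm
      rw [memX] at hm
      rcases hm.2.lt_or_eq with h1 | h1
      · exact (hcol k m hm.1.symm h1).le
      · exact (a.eq_of_cell_eq (hi ▸ h1) hm.1.symm).le
    have hlY : ∀ m ∈ Y, m ≤ l := by
      intro m hm
      rw [memY] at hm
      rcases hm.2.lt_or_eq with h1 | h1
      · exact (hcol m l hm.1 (by omega)).le
      · exact (a.eq_of_cell_eq (h1.trans hr) hm.1).le
    have hcardY : Y.card = i + 1 := by
      rw [← Finset.card_range (i + 1)]
      refine Finset.card_nbij a.rowOf ?_ ?_ ?_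
      · intro m hm
        rw [Finset.mem_coe, memY] at hm
        rw [Finset.mem_coe, Finset.mem_range]
        omega
      · intro m hm m' hm' h
        rw [Finset.mem_coe, memY] at hm hm'
        exact a.eq_of_cell_eq h (hm.1.trans hm'.1.symm)
      · intro r hr'
        rw [Finset.mem_coe, Finset.mem_range] at hr'
        obtain ⟨m, hm, hm'⟩ := a.exists_entry
          (YoungDiagram.up_left_mem μ (show r ≤ a.rowOf l by omega) le_rfl (a.mem l))
        exact ⟨m, by rw [Finset.mem_coe, memY]; exact ⟨hm', by omega⟩, hm⟩
    have hlen := a.rowOf_lt k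
    have hcard : (Finset.range (μ.colLen (a.colOf k))).card < (X ∪ Y).card := by
      rw [Finset.card_union_of_disjoint hXY, Tableau.card_colFrom, hcardY, Finset.card_range]
      omega
    have hz : YoungSymm.symm (permRep μ) Perm.sign (onSet (X ∪ Y)) (a.poly 0) = 0 := by
      refine symm_sign_eq_zero_of_rows fun x hx => ?_
      obtain ⟨q, hq, rfl⟩ := exists_of_poly_apply_ne_zero hx
      obtain ⟨m, hm, m', hm', hne, h⟩ := Finset.exists_ne_map_eq_of_card_lt_of_maps_to hcard
        (f := (q • a.tabloid).row) (by
          intro m hm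
          have h1 := (mem_stab_col.1 (inv_mem_stab hq)).1 m
          have h2 := a.rowOf_lt (q⁻¹ m)
          have h3 : a.colOf k ≤ a.colOf m := by
            rcases Finset.mem_union.1 hm with hm | hm
            · rw [memX] at hm
              omega
            · rw [memY] at hm
              omega
          have h4 := μ.colLen_anti _ _ h3
          rw [h1] at h2
          rw [Finset.mem_coe, Finset.mem_range, Tabloid.row_smul, Tabloid.row_tabloid]
          omega)
      exact ⟨m, hm, m', hm', hne, h⟩
    -- Column-preserving permutations each return the polytabloid itself, giving a positive multiple
    -- of it; this multiplicity is why only the saturation is reached. The other terms have larger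
    -- weight.
    rw [symm_apply, ← Finset.sum_filter_add_sum_filter_not _
      (fun σ : Perm (Fin μ.card) => ∀ m, a.colOf (σ m) = a.colOf m)] at hz
    have h1 : ∀ σ ∈ (stab (onSet (X ∪ Y))).filter
        (fun σ : Perm (Fin μ.card) => ∀ m, a.colOf (σ m) = a.colOf m),
        ((Perm.sign σ : ℤˣ) : ℤ) • permRep μ σ (a.poly 0) = a.poly 0 := by
      intro σ hσ
      rw [perm_poly (mem_stab_col.2 ⟨(Finset.mem_filter.1 hσ).2, by simp⟩), smul_smul,
        units_mul_self, one_smul]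
    rw [Finset.sum_congr rfl h1, Finset.sum_const, add_eq_zero_iff_eq_neg] at hz
    refine mem_saturation_of_nsmul (N := ((stab (onSet (X ∪ Y))).filter
      (fun σ : Perm (Fin μ.card) => ∀ m, a.colOf (σ m) = a.colOf m)).card)
      (Finset.card_pos.2 ⟨1, by simp [one_mem_stab]⟩) ?_
    rw [hz]
    refine neg_mem (Submodule.sum_mem _ fun σ hσ => Submodule.smul_mem _ _ ?_)
    rw [← poly_act]
    refine hW _ (Prod.Lex.left _ _ ?_)
    rw [Finset.mem_filter] at hσ
    have hτ := inv_mem_stab hσ.1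
    have hτ' : ¬ ∀ m, a.colOf (σ⁻¹ m) = a.colOf m := by
      intro h
      refine hσ.2 fun m => ?_
      rw [← h (σ m)]
      simp
    -- A finite set mapped into itself by σ⁻¹ is mapped onto itself, so its complement in the union
    -- is preserved too. Hence a permutation that changes columns must exchange entries in both
    -- directions.
    have hpres : ∀ A B : Finset (Fin μ.card), A ∪ B = X ∪ Y → (∀ m ∈ A, σ⁻¹ m ∈ A) →
        ∀ m ∈ B, m ∉ A → σ⁻¹ m ∈ B := by
      intro A B hAB hA m hm hmA
      have h2 := apply_mem_of_mem_stab_onSet hτ (k := m) (by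
        rw [← hAB, Finset.mem_union]; exact Or.inr hm)
      rw [← hAB, Finset.mem_union] at h2
      refine h2.resolve_left fun h3 => hmA ?_
      have h4 : A.image (fun m => σ⁻¹ m) = A := Finset.eq_of_subset_of_card_le
        (Finset.image_subset_iff.2 hA) (by rw [Finset.card_image_of_injective _ σ⁻¹.injective])
      rw [← h4, Finset.mem_image] at h3
      obtain ⟨m', hm', he⟩ := h3
      rwa [← σ⁻¹.injective he]
    have hall : (∀ m ∈ X, σ⁻¹ m ∈ X) → (∀ m ∈ Y, σ⁻¹ m ∈ Y) → False := by
      intro hXX hYY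
      refine hτ' fun m => ?_
      by_cases hmX : m ∈ X
      · rw [((memX _).1 (hXX m hmX)).1, ((memX _).1 hmX).1]
      by_cases hmY : m ∈ Y
      · rw [((memY _).1 (hYY m hmY)).1, ((memY _).1 hmY).1]
      rw [mem_stab_onSet.1 hτ m (by simp [hmX, hmY])]
    obtain ⟨x, hx, hx'⟩ : ∃ x ∈ X, σ⁻¹ x ∈ Y := by
      by_contra! hcon
      have hXX : ∀ m ∈ X, σ⁻¹ m ∈ X := fun m hm => by
        have := apply_mem_of_mem_stab_onSet hτ (Finset.mem_union_left Y hm)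
        exact (Finset.mem_union.1 this).resolve_right (hcon m hm)
      exact hall hXX fun m hm => hpres X Y rfl hXX m hm (Finset.disjoint_right.1 hXY hm)
    obtain ⟨y, hy, hy'⟩ : ∃ y ∈ Y, σ⁻¹ y ∈ X := by
      by_contra! hcon
      have hYY : ∀ m ∈ Y, σ⁻¹ m ∈ Y := fun m hm => by
        have := apply_mem_of_mem_stab_onSet hτ (Finset.mem_union_right X hm)
        exact (Finset.mem_union.1 this).resolve_left (hcon m hm)
      exact hall (fun m hm => hpres Y X (Finset.union_comm _ _) hYY m hm
        (Finset.disjoint_left.1 hXY hm)) hYY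
    refine sum_lt_sum_perm (K := X ∪ Y) ?_ hσ.1 ⟨y, Finset.mem_union_right _ hy, x,
      Finset.mem_union_left _ hx, ?_, ?_⟩
    · intro m hm m' hm' hlt
      rcases Finset.mem_union.1 hm' with h2 | h2
      · rcases Finset.mem_union.1 hm with h3 | h3
        · rw [((memX _).1 h2).1, ((memX _).1 h3).1]
        · rw [((memX _).1 h2).1, ((memY _).1 h3).1]
          exact hc.le
      · rcases Finset.mem_union.1 hm with h3 | h3
        · exact absurd ((hkX m h3).trans_lt (hlt.trans_le (hlY m' h2))) hlk.not_gt
        · rw [((memY _).1 h2).1, ((memY _).1 h3).1]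
    · exact ((hlY y hy).trans_lt hlk).trans_le (hkX x hx)
    · rw [((memX _).1 hy').1, ((memY _).1 hx').1]
      exact hc
  · push Not at hcol
    obtain ⟨k, l, hc, hr, hlk⟩ := hcol
    have hne : l < k := lt_of_le_of_ne hlk fun h => by rw [h] at hr; exact lt_irrefl _ hr
    have hs : swap k l ∈ stab (inside (a.lower 0) a.colOf) := by
      refine swap_mem_stab ?_
      simp [inside, Tableau.mem_lower, hc]
    have hb := hW (a.act (swap k l)) ?_
    · rw [poly_act, perm_poly hs, Perm.sign_swap hne.ne'] at hb
      simpa using hb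
    -- Exchanging two entries of a column leaves the column sum alone; moving the larger one down
    -- raises the row sum.
    · refine Prod.Lex.lt_iff.2 (Or.inr ⟨?_, ?_⟩)
      · change ∑ m : Fin _, (m : ℕ) * a.colOf m =
          ∑ m : Fin _, (m : ℕ) * Tableau.colOf (a.act (swap k l)) m
        refine Finset.sum_congr rfl fun m _ => ?_
        rw [Tableau.colOf_act, (mem_stab_col.1 (inv_mem_stab hs)).1]
      · refine sum_lt_sum_perm (K := {k, l}) ?_ (swap_mem_stab (by simp [onSet])) ⟨l, by simp, k,
          by simp, hne, by simpa using hr⟩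
        intro x hx y hy hxy
        simp only [Finset.mem_insert, Finset.mem_singleton] at hx hy
        rcases hx with rfl | rfl <;> rcases hy with rfl | rfl
        · exact le_rfl
        · exact absurd hxy hne.not_gt
        · exact hr.le
        · exact le_rfl

theorem poly_mem_saturation (a : Tableau μ) :
    a.poly 0 ∈ saturation (Submodule.span ℤ (Set.range fun s : Std μ => s.1.poly 0)) := by
  have wf : WellFounded fun b a : Tableau μ => a.weight < b.weight := by
    have h1 : IsTrans (Tableau μ) fun b a => a.weight < b.weight := ⟨fun _ _ _ h h' => h'.trans h⟩
    have h2 : Std.Irrefl fun b a : Tableau μ => a.weight < b.weight := ⟨fun _ h => lt_irrefl _ h⟩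
    exact Finite.wellFounded_of_trans_of_irrefl _
  induction a using wf.induction with
  | _ a ih =>
    by_cases ha : a.IsStandard
    · exact le_saturation _ (Submodule.subset_span ⟨⟨a, ha⟩, rfl⟩)
    · exact straighten a ha _ ih

theorem sum_std_apply (q : Std μ → ℤ) (t : Std μ) :
    (∑ s, q s • s.1.poly 0) t.1.tabloid = (stdMatrix μ).mulVec q t := by
  rw [Finsupp.finsetSum_apply]
  simp [Matrix.mulVec, dotProduct, stdMatrix, mul_comm]

theorem spechtModule_eq_span_std :
    spechtModule μ = Submodule.span ℤ (Set.range fun s : Std μ => s.1.poly 0) := by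
  apply le_antisymm
  · intro v hv
    have hsat : v ∈ saturation (Submodule.span ℤ (Set.range fun s : Std μ => s.1.poly 0)) := by
      rw [spechtModule_eq_span] at hv
      exact Submodule.span_le.2 (by rintro _ ⟨a, rfl⟩; exact poly_mem_saturation a) hv
    obtain ⟨N, hN, hNv⟩ := hsat
    obtain ⟨q, hq⟩ := (Submodule.mem_span_range_iff_exists_fun ℤ).1 hNv
    have h1 : (stdMatrix μ).mulVec q = N • fun t : Std μ => v t.1.tabloid := by
      ext t
      rw [← sum_std_apply, hq]
      simp
    -- The coefficients at the standard tabloids determine `q` through a matrix invertible over ℤ,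
    -- so `q` is divisible by `N`. This removes the denominators of the saturation.
    have h2 : q = N • (stdMatrix μ)⁻¹.mulVec fun t : Std μ => v t.1.tabloid := by
      rw [← Matrix.mulVec_smul, ← h1, Matrix.mulVec_mulVec, Matrix.nonsing_inv_mul, Matrix.one_mulVec]
      rw [det_stdMatrix]
      exact isUnit_one
    have h3 : v = ∑ s, ((stdMatrix μ)⁻¹.mulVec fun t : Std μ => v t.1.tabloid) s • s.1.poly 0 := by
      refine nsmul_right_injective hN.ne' ?_
      change N • v = N • _
      rw [← hq, Finset.smul_sum]
      refine Finset.sum_congr rfl fun s _ => ?_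
      conv_lhs => rw [h2, Pi.smul_apply]
      rw [smul_assoc]
    rw [h3]
    exact Submodule.sum_mem _ fun s _ =>
      Submodule.smul_mem _ _ (Submodule.subset_span ⟨s, rfl⟩)
  · refine Submodule.span_le.2 ?_
    rintro _ ⟨s, rfl⟩
    exact poly_mem_spechtModule s.1

theorem linearIndependent_std : LinearIndependent ℤ fun s : Std μ => s.1.poly 0 := by
  rw [Fintype.linearIndependent_iff]
  intro q hq
  have h1 : (stdMatrix μ).mulVec q = 0 := by
    ext t
    rw [← sum_std_apply, hq]
    rfl
  have h2 : q = 0 := by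
    rw [← Matrix.one_mulVec q, ← Matrix.nonsing_inv_mul (stdMatrix μ) (by simp [det_stdMatrix]),
      ← Matrix.mulVec_mulVec, h1, Matrix.mulVec_zero]
  exact fun s => congrFun h2 s

/-- The basis of the Specht module formed by the standard polytabloids. -/
noncomputable def stdBasis (μ : YoungDiagram) : Module.Basis (Std μ) ℤ (spechtModule μ) :=
  (Module.Basis.span linearIndependent_std).map (LinearEquiv.ofEq _ _ spechtModule_eq_span_std.symm)

theorem coe_stdBasis (s : Std μ) : (stdBasis μ s : PermModule μ) = s.1.poly 0 := by
  rw [stdBasis, Module.Basis.map_apply, LinearEquiv.coe_ofEq_apply, Module.Basis.span_apply]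

end Specht

/-! ### Elementary divisors of a square root of a scalar matrix -/

namespace ElementaryDivisors

/-- As in the Frobenius–König theorem, the block is so large that every term of the determinant has
a factor in it. -/
theorem dvd_det_of_block {n : ℕ} {Q : Matrix (Fin n) (Fin n) ℤ} {p : ℤ} (I J : Finset (Fin n))
    (hIJ : n < I.card + J.card) (h : ∀ i ∈ I, ∀ j ∈ J, p ∣ Q i j) : p ∣ Q.det := by
  classical
  rw [Matrix.det_apply]
  refine Finset.dvd_sum fun σ _ => ?_
  obtain ⟨j, hj, hσ⟩ : ∃ j ∈ J, σ j ∈ I := by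
    by_contra! hcon
    have hd : Disjoint I (J.map σ.toEmbedding) := by
      rw [Finset.disjoint_right]
      intro i hi
      obtain ⟨j, hj, rfl⟩ := Finset.mem_map.1 hi
      exact hcon j hj
    have h1 := Finset.card_le_univ (I ∪ J.map σ.toEmbedding)
    rw [Finset.card_union_of_disjoint hd, Finset.card_map, Fintype.card_fin] at h1
    omega
  have h1 : p ∣ ∏ j, Q (σ j) j := (h _ hσ j hj).trans (Finset.dvd_prod_of_mem _ (Finset.mem_univ j))
  rw [Units.smul_def, smul_eq_mul]
  exact Dvd.dvd.mul_left h1 _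

/-- Compare prime powers. If p^k divides d_i d_{rev i} but not c, divisibility forces p to divide
all entries of R with indices beyond i and `rev i`, a block with side lengths adding to n + 1,
contradicting unimodularity. The other direction uses Q and the opposite corner. -/
theorem mul_rev_eq_natAbs {n : ℕ} {d : Fin n → ℕ} (hd : ∀ i j, i ≤ j → d i ∣ d j)
    {Q R : Matrix (Fin n) (Fin n) ℤ} {c : ℤ} (hQ : IsUnit Q.det) (hR : IsUnit R.det)
    (h : ∀ i j, (d i * d j : ℤ) * Q i j = c * R i j) (i : Fin n) :
    d i * d i.rev = c.natAbs := by
  have hun : ∀ {p : ℕ} {S : Matrix (Fin n) (Fin n) ℤ}, p.Prime → IsUnit S.det →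
      ¬ (p : ℤ) ∣ S.det := by
    intro p S hp hS hdvd
    exact (Nat.prime_iff_prime_int.1 hp).not_isUnit (isUnit_of_dvd_unit hdvd hS)
  have hcop : ∀ {p k : ℕ} {x y : ℤ}, p.Prime → ((p ^ k : ℕ) : ℤ) ∣ x * y →
      ¬ ((p ^ k : ℕ) : ℤ) ∣ x → (p : ℤ) ∣ y := by
    intro p k x y hp hxy hx
    by_contra hy
    refine hx ?_
    push_cast at hxy ⊢
    exact IsCoprime.dvd_of_dvd_mul_right
      (((Nat.prime_iff_prime_int.1 hp).coprime_iff_not_dvd.2 hy).pow_left) hxy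
  apply Nat.dvd_antisymm
  · rw [Nat.dvd_iff_prime_pow_dvd_dvd]
    intro p k hp hk
    by_contra hc
    refine hun hp hR (dvd_det_of_block (Finset.Ici i) (Finset.Ici i.rev) ?_ fun i' hi' j' hj' => ?_)
    · rw [Fin.card_Ici, Fin.card_Ici, Fin.val_rev]
      omega
    · refine hcop (k := k) (x := c) hp ?_ fun h' => hc (Int.natCast_dvd.1 h')
      rw [← h]
      refine Dvd.dvd.mul_right ?_ _
      exact_mod_cast hk.trans (Nat.mul_dvd_mul (hd _ _ (Finset.mem_Ici.1 hi'))
        (hd _ _ (Finset.mem_Ici.1 hj')))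
  · rw [Nat.dvd_iff_prime_pow_dvd_dvd]
    intro p k hp hk
    by_contra hc
    refine hun hp hQ (dvd_det_of_block (Finset.Iic i) (Finset.Iic i.rev) ?_ fun i' hi' j' hj' => ?_)
    · rw [Fin.card_Iic, Fin.card_Iic, Fin.val_rev]
      omega
    · refine hcop (k := k) (x := (d i' * d j' : ℤ)) hp ?_ fun h' => hc ?_
      · rw [h]
        exact Dvd.dvd.mul_right (Int.natCast_dvd.2 hk) _
      · have h2 : p ^ k ∣ d i' * d j' := by exact_mod_cast h'
        exact h2.trans (Nat.mul_dvd_mul (hd _ _ (Finset.mem_Iic.1 hi'))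
          (hd _ _ (Finset.mem_Iic.1 hj')))

/-- If `P ^ 2 = c`, then the elementary divisors of `P` pair up to the products `|c|`. -/
theorem mul_rev_of_sq_eq {n : ℕ} {d : Fin n → ℕ} (hd : ∀ i j, i ≤ j → d i ∣ d j)
    {X P Y : Matrix (Fin n) (Fin n) ℤ} {c : ℤ} (hX : IsUnit X.det) (hY : IsUnit Y.det)
    (hP : P * P = c • (1 : Matrix (Fin n) (Fin n) ℤ))
    (h : X * P * Y = Matrix.diagonal fun i => (d i : ℤ)) (i : Fin n) :
    d i * d i.rev = c.natAbs := by
  -- With D = XPY one has D (Y⁻¹X⁻¹) D = X P² Y = c XY.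
  refine mul_rev_eq_natAbs hd (Q := Y⁻¹ * X⁻¹) (R := X * Y) (c := c) ?_ ?_ ?_ i
  · rw [Matrix.det_mul]
    exact (Matrix.isUnit_nonsing_inv_det Y hY).mul (Matrix.isUnit_nonsing_inv_det X hX)
  · rw [Matrix.det_mul]
    exact hX.mul hY
  · have key : Matrix.diagonal (fun i => (d i : ℤ)) * (Y⁻¹ * X⁻¹) *
        Matrix.diagonal (fun i => (d i : ℤ)) = c • (X * Y) := by
      rw [← h]
      calc X * P * Y * (Y⁻¹ * X⁻¹) * (X * P * Y)
          = X * P * (Y * Y⁻¹) * (X⁻¹ * X) * P * Y := by simp only [Matrix.mul_assoc]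
        _ = X * (P * P) * Y := by
          rw [Matrix.mul_nonsing_inv Y hY, Matrix.nonsing_inv_mul X hX, Matrix.mul_one,
            Matrix.mul_one, Matrix.mul_assoc X P P]
        _ = c • (X * Y) := by rw [hP, Matrix.mul_smul, Matrix.mul_one, Matrix.smul_mul]
    intro i j
    have h1 := congrFun (congrFun key i) j
    rw [Matrix.mul_diagonal, Matrix.diagonal_mul, Matrix.smul_apply, smul_eq_mul] at h1
    rw [← h1]
    ring

end ElementaryDivisors

/-! ### The middle jump factor -/

namespace Specht

open Equiv YoungSymm

variable {μ : YoungDiagram}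

theorem hookLength_pos (c : ℕ × ℕ) : 0 < hookLength μ c := Nat.succ_pos _

theorem hookProduct_pos : 0 < hookProduct μ := Finset.prod_pos fun c _ => hookLength_pos c

theorem hookLength_swap (h : μ.transpose = μ) (c : ℕ × ℕ) :
    hookLength μ c.swap = hookLength μ c := by
  have hr : ∀ i, μ.rowLen i = μ.colLen i := fun i => by
    conv_lhs => rw [← h]
    exact YoungDiagram.rowLen_transpose μ i
  simp only [hookLength, Prod.fst_swap, Prod.snd_swap, hr]
  omega

/-- Reflection pairs the cells above the diagonal with those below it, preserving hook lengths. -/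
theorem hookProduct_eq (h : μ.transpose = μ) :
    hookProduct μ = diagonalHookProduct μ * (∏ c ∈ μ.cells with c.1 < c.2, hookLength μ c) ^ 2 := by
  have h1 : ∏ c ∈ μ.cells with ¬ c.1 = c.2, hookLength μ c =
      (∏ c ∈ μ.cells with c.1 < c.2, hookLength μ c) *
        ∏ c ∈ μ.cells with c.2 < c.1, hookLength μ c := by
    rw [← Finset.prod_filter_mul_prod_filter_not (μ.cells.filter fun c => ¬ c.1 = c.2)
      (fun c => c.1 < c.2), Finset.filter_filter, Finset.filter_filter]
    congr 2
    · exact Finset.filter_congr fun c _ => by omega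
    · exact Finset.filter_congr fun c _ => by omega
  have h2 : ∏ c ∈ μ.cells with c.2 < c.1, hookLength μ c =
      ∏ c ∈ μ.cells with c.1 < c.2, hookLength μ c := by
    refine Finset.prod_bij' (fun c _ => c.swap) (fun c _ => c.swap) ?_ ?_ ?_ ?_ ?_
    · intro c hc
      rw [Finset.mem_filter] at hc ⊢
      exact ⟨swap_mem_cells h hc.1, hc.2⟩
    · intro c hc
      rw [Finset.mem_filter] at hc ⊢
      exact ⟨swap_mem_cells h hc.1, hc.2⟩
    · simp
    · simp
    · exact fun c _ => (hookLength_swap h c).symm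
  rw [hookProduct, diagonalHookProduct,
    ← Finset.prod_filter_mul_prod_filter_not μ.cells (fun c => c.1 = c.2), h1, h2, sq]

theorem card_std_eq : Fintype.card (Std μ) = spechtRank μ :=
  (Module.finrank_eq_card_basis (stdBasis μ)).symm

/-- The standard basis, numbered. -/
noncomputable def finBasis (μ : YoungDiagram) :
    Module.Basis (Fin (spechtRank μ)) ℤ (spechtModule μ) :=
  (stdBasis μ).reindex (Fintype.equivFinOfCardEq card_std_eq)

/-- The standard tableau of a number. -/
noncomputable def finTableau (i : Fin (spechtRank μ)) : Std μ :=
  (Fintype.equivFinOfCardEq card_std_eq).symm i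

theorem coe_finBasis (i : Fin (spechtRank μ)) :
    (finBasis μ i : PermModule μ) = (finTableau i).1.poly 0 := by
  rw [finBasis, Module.Basis.reindex_apply, coe_stdBasis, finTableau]

theorem spechtRank_pos : 0 < spechtRank μ := by
  by_contra h
  have he : IsEmpty (Std μ) := by
    rw [← Fintype.card_eq_zero_iff, card_std_eq]
    omega
  have h1 := poly_mem_spechtModule (baseTableau μ)
  rw [spechtModule_eq_span_std, Set.range_eq_empty, Submodule.span_empty, Submodule.mem_bot] at h1
  have h2 := poly_apply_self (baseTableau μ) 0
  rw [h1] at h2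
  simp at h2

/-! ### The twist on the Specht module and the Gram matrix -/

variable (h : μ.transpose = μ)

/-- The twist, restricted to the Specht module. -/
noncomputable def spechtTwist : Module.End ℤ (spechtModule μ) :=
  (twist h).restrict fun v _ => twist_mem h v

/-- The action of a permutation on the Specht module. -/
noncomputable def spechtPerm (σ : Perm (Fin μ.card)) : Module.End ℤ (spechtModule μ) :=
  (permRep μ σ).restrict fun _ hv => permRep_mem_spechtModule σ hv

theorem spechtTwist_mul_self :
    spechtTwist h * spechtTwist h = (transpSign h * hookProduct μ : ℤ) • 1 := by
  ext v : 2
  exact twist_twist h v.2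

/-- The matrix of the twist. -/
noncomputable def twistMatrix : Matrix (Fin (spechtRank μ)) (Fin (spechtRank μ)) ℤ :=
  LinearMap.toMatrix (finBasis μ) (finBasis μ) (spechtTwist h)

theorem twistMatrix_mul_self :
    twistMatrix h * twistMatrix h = (transpSign h * hookProduct μ : ℤ) • 1 := by
  rw [twistMatrix, ← LinearMap.toMatrix_mul, spechtTwist_mul_self, map_smul,
    LinearMap.toMatrix_one]

theorem transpSign_mul_ne_zero : (transpSign h * hookProduct μ : ℤ) ≠ 0 :=
  mul_ne_zero (Units.ne_zero _) (by exact_mod_cast hookProduct_pos.ne')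

theorem natAbs_transpSign_mul : (transpSign h * hookProduct μ : ℤ).natAbs = hookProduct μ := by
  rw [Int.natAbs_mul, Int.units_natAbs, one_mul, Int.natAbs_natCast]

/-- The twist anticommutes with a transposition; comparing determinants, both nonzero, gives
(-1)^rank = 1. -/
theorem even_spechtRank (h : μ.transpose = μ) (hcard : 1 < μ.card) : Even (spechtRank μ) := by
  set s : Perm (Fin μ.card) := swap ⟨0, by omega⟩ ⟨1, hcard⟩ with hs
  set S := LinearMap.toMatrix (finBasis μ) (finBasis μ) (spechtPerm s) with hS
  have hsign : Perm.sign s = -1 := Perm.sign_swap (by simp)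
  have h1 : spechtTwist h * spechtPerm s = -(spechtPerm s * spechtTwist h) := by
    ext v : 2
    change twist h (permRep μ s v) = -permRep μ s (twist h v)
    rw [twist_permRep, hsign]
    simp
  have h2 : spechtPerm s * spechtPerm s = 1 := by
    ext v : 2
    change permRep μ s (permRep μ s v) = v
    rw [← Module.End.mul_apply, ← map_mul, hs, swap_mul_self, map_one, Module.End.one_apply]
  have h1' : twistMatrix h * S = -(S * twistMatrix h) := by
    rw [twistMatrix, hS, ← LinearMap.toMatrix_mul, h1, map_neg, LinearMap.toMatrix_mul]
  have h2' : S * S = 1 := by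
    rw [hS, ← LinearMap.toMatrix_mul, h2, LinearMap.toMatrix_one]
  have d1 := congrArg Matrix.det h1'
  have d2 := congrArg Matrix.det h2'
  have d3 := congrArg Matrix.det (twistMatrix_mul_self h)
  rw [Matrix.det_neg, Matrix.det_mul, Matrix.det_mul, Fintype.card_fin] at d1
  rw [Matrix.det_mul, Matrix.det_one] at d2
  rw [Matrix.det_mul, Matrix.det_smul, Matrix.det_one, mul_one] at d3
  have hT : (twistMatrix h).det ≠ 0 := by
    intro h0
    rw [h0, zero_mul] at d3
    exact pow_ne_zero _ (transpSign_mul_ne_zero h) d3.symm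
  have hS0 : S.det ≠ 0 := by
    intro h0
    rw [h0] at d2
    simp at d2
  by_contra hodd
  rw [(Nat.not_even_iff_odd.1 hodd).neg_one_pow] at d1
  have : (2 : ℤ) * ((twistMatrix h).det * S.det) = 0 := by linarith
  exact mul_ne_zero two_ne_zero (mul_ne_zero hT hS0) this

theorem isStandard_transp {a : Tableau μ} (ha : a.IsStandard) : (a.transp h).IsStandard :=
  ⟨fun k l h1 h2 => ha.2 k l h1 h2, fun k l h1 h2 => ha.1 k l h1 h2⟩

/-- Transposition of standard tableaux. -/
def stdTransp : Perm (Std μ) where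
  toFun s := ⟨s.1.transp h, isStandard_transp h s.2⟩
  invFun s := ⟨s.1.transp h, isStandard_transp h s.2⟩
  left_inv s := Subtype.ext (transp_transp h s.1)
  right_inv s := Subtype.ext (transp_transp h s.1)

/-- The Gram matrix is the twist up to a unimodular factor. -/
theorem exists_gramMatrix_eq : ∃ F : Matrix (Fin (spechtRank μ)) (Fin (spechtRank μ)) ℤ,
    IsUnit F.det ∧ gramMatrix (finBasis μ) = F * twistMatrix h := by
  set e := Fintype.equivFinOfCardEq (card_std_eq (μ := μ)) with he
  -- Signs times the matrix of standard coefficients with rows permuted by transposition: row i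
  -- evaluates at the transpose of the i-th standard tableau, which is again standard.
  refine ⟨Matrix.diagonal (fun i => (((finTableau i).1.transp h).sgn * transpSign h : ℤ)) *
    ((stdMatrix μ).submatrix (stdTransp h) id).submatrix e.symm e.symm, ?_, ?_⟩
  · rw [Matrix.det_mul, Matrix.det_diagonal, Matrix.det_submatrix_equiv_self, Matrix.det_permute,
      det_stdMatrix, mul_one]
    refine IsUnit.mul ?_ (Units.isUnit _)
    rw [IsUnit.prod_univ_iff]
    exact fun i => (Units.isUnit _).mul (Units.isUnit _)
  · ext i j
    have h1 : twist h (finBasis μ j : PermModule μ) =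
        ∑ k, twistMatrix h k j • (finBasis μ k : PermModule μ) := by
      have h3 : spechtTwist h (finBasis μ j) = ∑ k, twistMatrix h k j • finBasis μ k := by
        conv_lhs => rw [← (finBasis μ).sum_repr (spechtTwist h (finBasis μ j))]
        simp only [twistMatrix, LinearMap.toMatrix_apply]
      have h4 := congrArg (Subtype.val) h3
      simpa [spechtTwist] using h4
    -- A polytabloid is ± the twist of a tabloid; moving the twist across the form turns the Gram
    -- entry into a coefficient of a twisted basis vector.
    have h5 : (finBasis μ i : PermModule μ) = ((((finTableau i).1.transp h).sgn : ℤˣ) : ℤ) •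
        twist h (Finsupp.single ((finTableau i).1.transp h).tabloid 1) := by
      rw [twist_single, smul_smul, units_mul_self, one_smul, transp_transp, coe_finBasis]
    rw [gramMatrix, Matrix.of_apply, h5, map_smul, LinearMap.smul_apply, form_twist,
      form_single_left, h1, Matrix.mul_assoc, Matrix.diagonal_mul, Finsupp.finsetSum_apply,
      Matrix.mul_apply, smul_eq_mul, mul_assoc]
    congr 2
    refine Finset.sum_congr rfl fun k _ => ?_
    rw [Finsupp.smul_apply, coe_finBasis, smul_eq_mul, mul_comm]
    rfl

theorem gramMatrix_eq {r : ℕ} (b b' : Module.Basis (Fin r) ℤ (spechtModule μ)) :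
    gramMatrix b = (b'.toMatrix b).transpose * gramMatrix b' * b'.toMatrix b := by
  ext i j
  have hb : ∀ i, (b i : PermModule μ) = ∑ k, b'.toMatrix b k i • (b' k : PermModule μ) := by
    intro i
    have h1 := congrArg Subtype.val (b'.sum_toMatrix_smul_self b i)
    exact h1.symm.trans (map_sum (spechtModule μ).subtype _ _)
  rw [gramMatrix, Matrix.of_apply, hb i, hb j, Matrix.mul_assoc, Matrix.mul_apply,
    map_sum (form μ), LinearMap.sum_apply]
  refine Finset.sum_congr rfl fun k _ => ?_
  rw [map_smul, LinearMap.smul_apply, map_sum, Matrix.mul_apply, Matrix.transpose_apply,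
    smul_eq_mul]
  congr 1
  refine Finset.sum_congr rfl fun l _ => ?_
  rw [map_smul, smul_eq_mul, gramMatrix, Matrix.of_apply, mul_comm]

theorem elementaryDivisors_mul_rev (h : μ.transpose = μ)
    (b : Module.Basis (Fin (spechtRank μ)) ℤ (spechtModule μ)) (i : Fin (spechtRank μ)) :
    ElementaryDivisors.elementaryDivisors (gramMatrix b) i *
      ElementaryDivisors.elementaryDivisors (gramMatrix b) i.rev = hookProduct μ := by
  obtain ⟨hd, U, V, hU, hV, hUV⟩ :=
    (ElementaryDivisors.exists_isSmithForm (gramMatrix b)).choose_spec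
  obtain ⟨F, hF, hG⟩ := exists_gramMatrix_eq h
  set C := (finBasis μ).toMatrix b with hC
  have hCu : IsUnit C.det := by
    have h1 : C * b.toMatrix (finBasis μ) = 1 := (finBasis μ).toMatrix_mul_toMatrix_flip b
    have h2 := congrArg Matrix.det h1
    rw [Matrix.det_mul, Matrix.det_one] at h2
    exact IsUnit.of_mul_eq_one _ h2
  have hb := gramMatrix_eq b (finBasis μ)
  rw [hG, ← hC] at hb
  rw [← natAbs_transpSign_mul h]
  refine ElementaryDivisors.mul_rev_of_sq_eq hd (X := U * C.transpose * F) (P := twistMatrix h)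
    (Y := C * V) ?_ ?_ (twistMatrix_mul_self h) ?_ i
  · rw [Matrix.det_mul, Matrix.det_mul, Matrix.det_transpose]
    exact (hU.mul hCu).mul hF
  · rw [Matrix.det_mul]
    exact hCu.mul hV
  · refine Eq.trans ?_ hUV
    rw [hb]
    simp only [Matrix.mul_assoc]

end Specht

theorem mainTheorem12 (μ : YoungDiagram) (hsymm : μ.transpose = μ)
    (hempty : μ.cells ≠ ∅) (hone : μ.cells ≠ {(0, 0)})
    (b : Module.Basis (Fin (Specht.spechtRank μ)) ℤ (Specht.spechtModule μ)) :
    Even (Specht.spechtRank μ) ∧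
    (∀ k, 0 < ElementaryDivisors.elementaryDivisors (Specht.gramMatrix b) k) ∧
    ∃ i j : Fin (Specht.spechtRank μ),
      (i : ℕ) + 1 = Specht.spechtRank μ / 2 ∧
      (j : ℕ) + 1 = Specht.spechtRank μ / 2 + 1 ∧
      IsSquare ((Specht.diagonalHookProduct μ : ℚ) /
        ((ElementaryDivisors.elementaryDivisors (Specht.gramMatrix b) j : ℚ) /
          (ElementaryDivisors.elementaryDivisors (Specht.gramMatrix b) i : ℚ))) := by
  have hcard : 1 < μ.card := by
    obtain ⟨c, hc⟩ := Finset.nonempty_iff_ne_empty.2 hempty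
    have h0 : (0, 0) ∈ μ.cells := (YoungDiagram.mem_cells _).2
      (μ.up_left_mem (Nat.zero_le c.1) (Nat.zero_le c.2) ((YoungDiagram.mem_cells _).1 hc))
    refine Finset.one_lt_card_iff_nontrivial.2 ⟨(0, 0), h0, ?_⟩
    by_contra! hcon
    exact hone (Finset.eq_singleton_iff_unique_mem.2 ⟨h0, fun c hc => (hcon c hc).symm⟩)
  have heven := Specht.even_spechtRank hsymm hcard
  have hpos := Specht.spechtRank_pos (μ := μ)
  have hmul := Specht.elementaryDivisors_mul_rev hsymm b
  have hd : ∀ k, 0 < ElementaryDivisors.elementaryDivisors (Specht.gramMatrix b) k := by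
    intro k
    refine Nat.pos_of_ne_zero fun h0 => ?_
    have h1 := hmul k
    rw [h0, zero_mul] at h1
    exact Specht.hookProduct_pos.ne h1
  obtain ⟨m, hm⟩ := heven
  have hrank : Specht.spechtRank μ / 2 = m := by omega
  -- With indices from 0 and rank 2m, the two middle divisors have indices m - 1 and m, which
  -- `Fin.rev` exchanges.
  refine ⟨⟨m, hm⟩, hd, ⟨m - 1, by omega⟩, ⟨m, by omega⟩, ?_, ?_, ?_⟩
  · simp only [hrank]
    omega
  · simp only [hrank]
  · have hrev : Fin.rev (⟨m - 1, by omega⟩ : Fin (Specht.spechtRank μ)) = ⟨m, by omega⟩ := by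
      ext
      rw [Fin.val_rev]
      simp only
      omega
    have h1 := hmul ⟨m - 1, by omega⟩
    have h2 := hd ⟨m - 1, by omega⟩
    have h3 := hd ⟨m, by omega⟩
    rw [hrev, Specht.hookProduct_eq hsymm] at h1
    set x := ElementaryDivisors.elementaryDivisors (Specht.gramMatrix b) ⟨m - 1, by omega⟩
    set y := ElementaryDivisors.elementaryDivisors (Specht.gramMatrix b) ⟨m, by omega⟩
    set o := ∏ c ∈ μ.cells with c.1 < c.2, Specht.hookLength μ c
    have ho : (o : ℚ) ≠ 0 := by
      exact_mod_cast (Finset.prod_pos fun c _ => Specht.hookLength_pos c).ne'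
    have hx : (x : ℚ) ≠ 0 := by exact_mod_cast h2.ne'
    have hy : (y : ℚ) ≠ 0 := by exact_mod_cast h3.ne'
    have h4 : (x : ℚ) * y = Specht.diagonalHookProduct μ * o ^ 2 := by exact_mod_cast h1
    -- From xy = H o² follows H / (y / x) = (x / o)².
    refine ⟨x / o, ?_⟩
    field_simp
    linarith
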